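/- Notation. For a Polish group $G$ (written additively), $E(G)$ is the equivalence relation on the product space $G^{\omega}$ given by $x\,E(G)\,y$ iff the sequence $(x(n)-y(n))_{n}$ converges in $G$. $E_0$ is the equivalence relation on $2^{\omega}$ given by $x\,E_0\,y$ iff $x(n)=y(n)$ for all but finitely many $n$. For equivalence relations $E,F$ on Polish spaces $X,Y$, $E\leq_B F$ means that there is a Borel map $f\colon X\to Y$ with $x\,E\,y\iff f(x)\,F\,f(y)$ for all $x,y\in X$; $E\sim_B F$ means $E\leq_B F$ and $F\leq_B E$; and $E<_B F$ means $E\leq_B F$ and $F\not\leq_B E$. For $p\in[1,\infty)$ let $l_p$ be the real Banach space of $p$-summable sequences, regarded as an additive Polish group. For a real sequence $a\in c_0$ (that is, $a(n)\to 0$) put $$I_a=\{n\in\omega: a(n)\neq 0\},\qquad A_{p,a}=\{v\in l_p:\forall n\ (v(n)\in a(n)\mathbb{Z})\},$$ $$A_p=\{v\in l_p:\forall n\ (v(n)\in 2^{-n}\mathbb{Z})\},$$ where the subgroups $A_{p,a}$ and $A_p$ carry the topology inherited from $l_p$. Theorem. For all $p,q\in[1,\infty)$ and $a\in c_0$: 1.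 if $I_a$ is nonempty and finite, then $E(A_{p,a})\sim_B E_0$; 2. if $I_a$ is infinite, then $E(A_{p,a})\sim_B E(A_p)$; 3. $E(A_p)<_B E(l_p)$; 4. $E(A_p)\leq_B E(l_q)$ if and only if $p=q$; 5. $E(A_p)\leq_B E(A_q)$ if and only if $p=q$. -/

import Mathlib

open Filter Topology
open scoped ENNReal

/-- `E` is Borel reducible to `F`: there is a Borel map `f` with `x E y ↔ f x F f y`. -/
def BorelReducible {X Y : Type*} [TopologicalSpace X] [TopologicalSpace Y]
    (E : Setoid X) (F : Setoid Y) : Prop :=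
  ∃ f : X → Y, @Measurable X Y (borel X) (borel Y) f ∧ ∀ x y : X, E.r x y ↔ F.r (f x) (f y)

/-- `E` and `F` are Borel bireducible. -/
def BorelBireducible {X Y : Type*} [TopologicalSpace X] [TopologicalSpace Y]
    (E : Setoid X) (F : Setoid Y) : Prop :=
  BorelReducible E F ∧ BorelReducible F E

/-- `E` is strictly below `F` in the order of Borel reducibility. -/
def StrictlyBorelReducible {X Y : Type*} [TopologicalSpace X] [TopologicalSpace Y]
    (E : Setoid X) (F : Setoid Y) : Prop :=
  BorelReducible E F ∧ ¬ BorelReducible F E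

/-- The equivalence relation of eventual equality on the Cantor space `ℕ → Bool`. -/
def eqRelE0 : Setoid (ℕ → Bool) where
  r x y := ∃ m : ℕ, ∀ n > m, x n = y n
  iseqv :=
    { refl := fun _ => ⟨0, fun _ _ => rfl⟩
      symm := fun ⟨m, h⟩ => ⟨m, fun n hn => (h n hn).symm⟩
      trans := fun ⟨m, h⟩ ⟨k, h'⟩ => ⟨max m k, fun n hn =>
        (h n (lt_of_le_of_lt (le_max_left m k) hn)).trans
          (h' n (lt_of_le_of_lt (le_max_right m k) hn))⟩ }

/-- The equivalence relation `E(G)` induced by a topological group `G`, written additively: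
two sequences in `G` are equivalent when their termwise difference converges in `G`.
The space `ℕ → G` carries the product topology. -/
def inducedEqRel (G : Type*) [AddGroup G] [TopologicalSpace G] [IsTopologicalAddGroup G] :
    Setoid (ℕ → G) where
  r x y := ∃ l : G, Tendsto (fun n => x n - y n) atTop (𝓝 l)
  iseqv :=
    { refl := fun x => ⟨0, by simpa using tendsto_const_nhds⟩
      symm := fun {x y} ⟨l, h⟩ => ⟨-l, by simpa using h.neg⟩
      trans := fun {x y z} ⟨l, h⟩ ⟨l', h'⟩ => ⟨l + l', by simpa using h.add h'⟩ }

/-- The real sequence space `l_p`, with its norm topology when `1 ≤ p`. -/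
abbrev SeqLp (p : ℝ≥0∞) : Type := lp (fun _ : ℕ => ℝ) p

/-- The subgroup `A_{p,a} = {v ∈ l_p : v(n) ∈ a(n)ℤ for all n}` of `l_p`; as a type it carries the
topology inherited from `l_p`. -/
def subgroupA (p : ℝ≥0∞) (a : ℕ → ℝ) : AddSubgroup (SeqLp p) where
  carrier := {v | ∀ n, v n ∈ AddSubgroup.zmultiples (a n)}
  zero_mem' := fun n => (AddSubgroup.zmultiples (a n)).zero_mem
  add_mem' := fun hv hw n => (AddSubgroup.zmultiples (a n)).add_mem (hv n) (hw n)
  neg_mem' := fun hv n => (AddSubgroup.zmultiples (a n)).neg_mem (hv n)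

/-- The subgroup `A_p = {v ∈ l_p : v(n) ∈ 2⁻ⁿℤ for all n}`. -/
noncomputable def subgroupDyadic (p : ℝ≥0∞) : AddSubgroup (SeqLp p) :=
  subgroupA p (fun n => ((2 : ℝ) ^ n)⁻¹)

/-! The reductions come from explicit maps. If `I_a` is finite, `A_{p,a}` is countable and discrete,
and a sequence in it is coded by its increments (`inducedEqRel_borelReducible_eqRelE0`). If `b` is
null with infinite support, moving coordinates to sparse places and rescaling them by factors of
modulus in `[1/2, 1]` embeds `A_{p,a}` in `A_{p,b}` (`subgroupA_borelReducible_subgroupA`).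

The nonreductions rest on one rigidity argument. A Borel map is continuous on a dense `Gδ` set, and
a category construction makes its increments over successive time blocks depend on one coordinate
each, up to summable errors (`exists_almost_local`). Hence every null sequence in the source has a
counterpart `u` in the target with the same convergent signed subseries
(`exists_seriesConverges_iff`). For the sequence that repeats `2⁻ᵐ V m` exactly `2 ^ m` times, signs
recover dyadic scalars: in late blocks the sums of `u` over residue classes modulo `2 ^ r` are
almost equal, so each is about `2⁻ʳ` times the whole block sum. Thus a subsequence of `V` and a
sequence `v` of block sums have the same convergent series with signed dyadic null coefficients
(`exists_dyadicEquiv`), and `2⁻ʳ v i` stays near the subgroup where the reduction takes its values.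

With `V` the unit vectors of `l_p`, convergence on the source side is `p`-summability of the
coefficients, and on the target side, after taking differences and a gliding hump, `q`-summability;
dyadic sequences separate `p` from `q`. With `V` constant and values in `A_p`, nearness to `A_p` at
all dyadic scales makes `v` coordinatewise null (`abs_le_of_near_multiples`). Along a subsequence,
convergence for `v` then ignores signs, whereas for a constant vector an alternating series may
converge when the positive one diverges. -/

open Finset (range)

/-! ### Convergent series -/

/-- The partial sums of `f` converge (not necessarily unconditionally). -/
def SeriesConverges {E : Type*} [AddCommMonoid E] [TopologicalSpace E] (f : ℕ → E) : Prop :=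
  ∃ l : E, Tendsto (fun n => ∑ i ∈ range n, f i) atTop (𝓝 l)

theorem StrictMono.exists_block {K : ℕ → ℕ} (hK : StrictMono K) {k : ℕ} (hk : K 0 ≤ k) :
    ∃ j, K j ≤ k ∧ k < K (j + 1) := by
  have hex : ∃ j, k < K j := ⟨k + 1, lt_of_lt_of_le (Nat.lt_succ_self k) (hK.id_le _)⟩
  obtain ⟨j, hj⟩ : ∃ j, Nat.find hex = j + 1 := by
    refine Nat.exists_eq_succ_of_ne_zero fun h0 => ?_
    have := Nat.find_spec hex
    rw [h0] at this
    omega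
  refine ⟨j, ?_, hj ▸ Nat.find_spec hex⟩
  exact not_lt.1 (Nat.find_min hex (by omega))

/-- A sequence that converges along the end points of a partition of `ℕ` into blocks, and
oscillates less and less inside the blocks, converges. -/
theorem tendsto_of_tendsto_block {E : Type*} [SeminormedAddCommGroup E] {s : ℕ → E} {K : ℕ → ℕ}
    {l : E} (hK : StrictMono K) (hl : Tendsto (fun j => s (K j)) atTop (𝓝 l))
    (hs : ∀ ε > 0, ∃ J, ∀ j ≥ J, ∀ k, K j ≤ k → k < K (j + 1) → ‖s k - s (K j)‖ ≤ ε) :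
    Tendsto s atTop (𝓝 l) := by
  rw [Metric.tendsto_atTop] at hl ⊢
  intro ε hε
  obtain ⟨J, hJ⟩ := hl (ε / 2) (by positivity)
  obtain ⟨J', hJ'⟩ := hs (ε / 4) (by positivity)
  refine ⟨K (max J J'), fun k hk => ?_⟩
  obtain ⟨j, hj1, hj2⟩ := hK.exists_block (le_trans (hK.monotone (Nat.zero_le _)) hk)
  have hj : max J J' ≤ j := by
    by_contra! h
    have := hK.monotone (Nat.succ_le_of_lt h)
    simp only [Nat.succ_eq_add_one] at this
    omega
  have h1 := hJ j (le_trans (le_max_left _ _) hj)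
  have h2 := hJ' j (le_trans (le_max_right _ _) hj) k hj1 hj2
  rw [← dist_eq_norm] at h2
  linarith [dist_triangle (s k) (s (K j)) l]

/-- Oscillation of a convergent sequence. -/
theorem exists_norm_sub_le_of_tendsto {E : Type*} [SeminormedAddCommGroup E] {s : ℕ → E} {l : E}
    (hl : Tendsto s atTop (𝓝 l)) {ε : ℝ} (hε : 0 < ε) :
    ∃ J, ∀ m ≥ J, ∀ n ≥ J, ‖s m - s n‖ ≤ ε := by
  obtain ⟨J, hJ⟩ := Metric.cauchySeq_iff.1 hl.cauchySeq ε hε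
  exact ⟨J, fun m hm n hn => by rw [← dist_eq_norm]; exact (hJ m hm n hn).le⟩

theorem SeriesConverges.tendsto_zero {E : Type*} [SeminormedAddCommGroup E] {f : ℕ → E}
    (h : SeriesConverges f) : Tendsto f atTop (𝓝 0) := by
  obtain ⟨l, hl⟩ := h
  have := ((tendsto_add_atTop_iff_nat 1).2 hl).sub hl
  simpa [Finset.sum_range_succ] using this

theorem SeriesConverges.exists_norm_sum_Ico_le {E : Type*} [SeminormedAddCommGroup E] {f : ℕ → E}
    (h : SeriesConverges f) {ε : ℝ} (hε : 0 < ε) :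
    ∃ J, ∀ m ≥ J, ∀ n ≥ m, ‖∑ i ∈ Finset.Ico m n, f i‖ ≤ ε := by
  obtain ⟨l, hl⟩ := h
  obtain ⟨J, hJ⟩ := exists_norm_sub_le_of_tendsto hl hε
  refine ⟨J, fun m hm n hn => ?_⟩
  rw [Finset.sum_Ico_eq_sub _ hn]
  exact hJ n (hm.trans hn) m hm

theorem SeriesConverges.add {E : Type*} [SeminormedAddCommGroup E] {f g : ℕ → E}
    (hf : SeriesConverges f) (hg : SeriesConverges g) : SeriesConverges (fun i => f i + g i) := by
  obtain ⟨l, hl⟩ := hf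
  obtain ⟨l', hl'⟩ := hg
  exact ⟨l + l', by simpa [Finset.sum_add_distrib] using hl.add hl'⟩

theorem SeriesConverges.of_summable {E : Type*} [SeminormedAddCommGroup E] {f : ℕ → E}
    (hf : Summable f) : SeriesConverges f :=
  ⟨_, hf.hasSum.tendsto_sum_nat⟩

/-- A summable perturbation does not affect convergence. -/
theorem SeriesConverges.of_norm_sub_le {E : Type*} [NormedAddCommGroup E] [CompleteSpace E]
    {f g : ℕ → E} {b : ℕ → ℝ} (hb : Summable b) (hfg : ∀ i, ‖f i - g i‖ ≤ b i)
    (hg : SeriesConverges g) : SeriesConverges f := by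
  have := (SeriesConverges.of_summable (Summable.of_norm_bounded hb hfg)).add hg
  simpa using this

theorem seriesConverges_iff_of_norm_sub_le {E : Type*} [NormedAddCommGroup E] [CompleteSpace E]
    {f g : ℕ → E} {b : ℕ → ℝ} (hb : Summable b) (hfg : ∀ i, ‖f i - g i‖ ≤ b i) :
    SeriesConverges f ↔ SeriesConverges g :=
  ⟨SeriesConverges.of_norm_sub_le hb fun i => by rw [norm_sub_rev]; exact hfg i,
    SeriesConverges.of_norm_sub_le hb hfg⟩

/-- Block sums of a convergent series form a convergent series. -/
theorem SeriesConverges.block {E : Type*} [SeminormedAddCommGroup E] {f : ℕ → E} {K : ℕ → ℕ}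
    (hK : StrictMono K) (hf : SeriesConverges f) :
    SeriesConverges (fun j => ∑ i ∈ Finset.Ico (K j) (K (j + 1)), f i) := by
  obtain ⟨l, hl⟩ := hf
  refine ⟨l - ∑ i ∈ range (K 0), f i, ?_⟩
  have h2 := (hl.comp hK.tendsto_atTop).sub_const (∑ i ∈ range (K 0), f i)
  refine h2.congr fun n => ?_
  simp only [Function.comp]
  induction n with
  | zero => simp
  | succ n ih =>
    rw [Finset.sum_range_succ, ← ih, Finset.sum_Ico_eq_sub _ (hK.monotone (Nat.le_succ n))]
    abel

/-- Converse of `SeriesConverges.block` when the partial sums inside the blocks are small. -/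
theorem SeriesConverges.of_block {E : Type*} [SeminormedAddCommGroup E] {f : ℕ → E} {K : ℕ → ℕ}
    (hK : StrictMono K)
    (hf : SeriesConverges (fun j => ∑ i ∈ Finset.Ico (K j) (K (j + 1)), f i))
    (hs : ∀ ε > 0, ∃ J, ∀ j ≥ J, ∀ k, K j ≤ k → k < K (j + 1) →
      ‖∑ i ∈ Finset.Ico (K j) k, f i‖ ≤ ε) : SeriesConverges f := by
  obtain ⟨l, hl⟩ := hf
  refine ⟨(∑ i ∈ range (K 0), f i) + l, tendsto_of_tendsto_block hK ?_ ?_⟩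
  · refine (hl.const_add (∑ i ∈ range (K 0), f i)).congr fun n => ?_
    induction n with
    | zero => simp
    | succ n ih =>
      rw [Finset.sum_range_succ, ← add_assoc, ih,
        Finset.sum_Ico_eq_sub _ (hK.monotone (Nat.le_succ n))]
      abel
  · intro ε hε
    obtain ⟨J, hJ⟩ := hs ε hε
    refine ⟨J, fun j hj k hk hk' => ?_⟩
    rw [← Finset.sum_Ico_eq_sub _ hk]
    exact hJ j hj k hk hk'

theorem sum_Ico_extend {E : Type*} [AddCommMonoid E] {N : ℕ → ℕ} (hN : StrictMono N)
    (f : ℕ → E) {j k : ℕ} (h1 : N j < k) (h2 : k ≤ N (j + 1)) :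
    ∑ i ∈ Finset.Ico (N j) k, Function.extend N f 0 i = f j := by
  rw [Finset.sum_eq_single (N j), hN.injective.extend_apply]
  · intro i hi hne
    rw [Finset.mem_Ico] at hi
    rw [Function.extend_apply', Pi.zero_apply]
    rintro ⟨a, rfl⟩
    have h3 : j < a := hN.lt_iff_lt.1 (lt_of_le_of_ne hi.1 (Ne.symm hne))
    have h4 : a < j + 1 := hN.lt_iff_lt.1 (lt_of_lt_of_le hi.2 h2)
    omega
  · intro h
    exact absurd (Finset.mem_Ico.2 ⟨le_rfl, h1⟩) h

/-- Inserting zeros does not affect convergence. -/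
theorem seriesConverges_extend {E : Type*} [SeminormedAddCommGroup E] {N : ℕ → ℕ}
    (hN : StrictMono N) (f : ℕ → E) :
    SeriesConverges (Function.extend N f 0) ↔ SeriesConverges f := by
  have key : (fun j => ∑ i ∈ Finset.Ico (N j) (N (j + 1)), Function.extend N f 0 i) = f :=
    funext fun j => sum_Ico_extend hN f (hN (Nat.lt_succ_self j)) le_rfl
  refine ⟨fun h => key ▸ h.block hN, fun h => SeriesConverges.of_block hN (key.symm ▸ h) ?_⟩
  intro ε hε
  obtain ⟨J, hJ⟩ := Metric.tendsto_atTop.1 h.tendsto_zero ε hε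
  refine ⟨J, fun j hj k hk hk' => ?_⟩
  rcases hk.eq_or_lt with rfl | hlt
  · simpa using hε.le
  · rw [sum_Ico_extend hN f hlt hk'.le]
    simpa using (hJ j hj).le

theorem seriesConverges_nonneg_iff {f : ℕ → ℝ} (hf : ∀ i, 0 ≤ f i) :
    SeriesConverges f ↔ Summable f :=
  ⟨fun ⟨_, hl⟩ => ((hasSum_iff_tendsto_nat_of_nonneg hf _).2 hl).summable,
    SeriesConverges.of_summable⟩

/-- Along a frequently true property, a null sequence can be thinned out to be summable. -/
theorem exists_strictMono_le_pow {t : ℕ → ℝ} (ht : Tendsto t atTop (𝓝 0)) {P : ℕ → Prop}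
    (hP : ∃ᶠ n in atTop, P n) :
    ∃ φ : ℕ → ℕ, StrictMono φ ∧ ∀ n, P (φ n) ∧ t (φ n) ≤ (1 / 2) ^ n :=
  extraction_forall_of_frequently fun n =>
    hP.and_eventually ((ht.eventually (gt_mem_nhds (by positivity : (0 : ℝ) < (1 / 2) ^ n))).mono
      fun _ h => h.le)

theorem summable_half_pow : Summable (fun n : ℕ => ((1 : ℝ) / 2) ^ n) := summable_geometric_two

/-! ### Baire category on `ℕ → Γ` -/

/-- A Borel function into a second countable space is continuous on a dense `Gδ` set. -/
theorem exists_dense_isGδ_continuousOn {X Y : Type*} [TopologicalSpace X] [BaireSpace X]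
    [TopologicalSpace Y] [SecondCountableTopology Y] {f : X → Y}
    (hf : @Measurable X Y (borel X) (borel Y) f) :
    ∃ C : Set X, IsGδ C ∧ Dense C ∧ ContinuousOn f C := by
  obtain ⟨B, hBc, -, hB⟩ := TopologicalSpace.exists_countable_basis Y
  -- Borel sets are open up to a meagre set, and a countable basis produces only countably many
  -- meagre exceptions.
  have h : ∀ b ∈ B, ∃ u : Set X, IsOpen u ∧ ((f ⁻¹' b : Set X) =ᶠ[residual X] u) := by
    intro b hb
    borelize X
    refine MeasurableSet.residualEq_isOpen ?_
    have : @MeasurableSet Y (borel Y) b :=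
      MeasurableSpace.measurableSet_generateFrom (hB.isOpen hb)
    exact hf this
  choose! u hu1 hu2 using h
  have hres : {x | ∀ b ∈ B, x ∈ f ⁻¹' b ↔ x ∈ u b} ∈ residual X := by
    have : ∀ᶠ x in residual X, ∀ b ∈ B, (x ∈ f ⁻¹' b ↔ x ∈ u b) := by
      rw [eventually_countable_ball hBc]
      exact fun b hb => (hu2 b hb).mem_iff
    exact this
  obtain ⟨C, hC, hCG, hCd⟩ := mem_residual.1 hres
  refine ⟨C, hCG, hCd, fun x hx => ?_⟩
  rw [ContinuousWithinAt, hB.nhds_hasBasis.tendsto_right_iff]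
  rintro b ⟨hb, hxb⟩
  have hxu : x ∈ u b := (hC hx b hb).1 hxb
  filter_upwards [mem_nhdsWithin_of_mem_nhds ((hu1 b hb).mem_nhds hxu), self_mem_nhdsWithin]
    with y hy hyC
  exact (hC hyC b hb).2 hy

/-- The points of `ℕ → Γ` that agree with `z` below `n`. -/
def cylinder {Γ : Type*} (z : ℕ → Γ) (n : ℕ) : Set (ℕ → Γ) := {w | ∀ i < n, w i = z i}

theorem self_mem_cylinder {Γ : Type*} (z : ℕ → Γ) (n : ℕ) : z ∈ cylinder z n := fun _ _ => rfl

theorem isOpen_cylinder {Γ : Type*} [TopologicalSpace Γ] [DiscreteTopology Γ]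
    (z : ℕ → Γ) (n : ℕ) : IsOpen (cylinder z n) := by
  have : cylinder z n = Set.pi (Set.Iio n) fun i => {z i} := by
    ext w; simp [cylinder, Set.mem_pi]
  rw [this]
  exact isOpen_set_pi (Set.finite_Iio n) fun _ _ => isOpen_discrete _

theorem exists_cylinder_subset {Γ : Type*} [TopologicalSpace Γ] {z : ℕ → Γ} {U : Set (ℕ → Γ)}
    (hU : U ∈ 𝓝 z) :
    ∃ n, cylinder z n ⊆ U := by
  rw [nhds_pi, Filter.mem_pi'] at hU
  obtain ⟨I, t, ht, hU⟩ := hU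
  refine ⟨I.sup id + 1, fun w hw => hU fun i hi => ?_⟩
  rw [hw i (Nat.lt_succ_of_le (Finset.le_sup (f := id) hi))]
  exact mem_of_mem_nhds (ht i)

/-- There are only countably many finitely supported sequences over `Γ`, so intersecting all the
translates of a continuity set keeps it a dense `Gδ` and makes it invariant under finite changes. -/
theorem exists_dense_isGδ_continuousOn_add {Γ : Type*} [AddCommGroup Γ] [TopologicalSpace Γ]
    [DiscreteTopology Γ] [Countable Γ] {Y : Type*} [TopologicalSpace Y] [SecondCountableTopology Y]
    {Θ : (ℕ → Γ) → Y}
    (hΘ : @Measurable _ _ (borel (ℕ → Γ)) (borel Y) Θ) :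
    ∃ C : Set (ℕ → Γ), IsGδ C ∧ Dense C ∧ (∀ (h : ℕ →₀ Γ), ∀ w ∈ C, w + ⇑h ∈ C) ∧
      ∀ h : ℕ →₀ Γ, ContinuousOn (fun w => Θ (w + ⇑h)) C := by
  have : PolishSpace Γ := inferInstance
  obtain ⟨C, hG, hd, hc⟩ := exists_dense_isGδ_continuousOn hΘ
  let τ : (ℕ →₀ Γ) → (ℕ → Γ) ≃ₜ (ℕ → Γ) := fun h => Homeomorph.addRight (⇑h)
  refine ⟨⋂ h : ℕ →₀ Γ, τ h ⁻¹' C, ?_, ?_, ?_, ?_⟩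
  · exact IsGδ.iInter fun h => hG.preimage (τ h).continuous
  · exact dense_iInter_of_Gδ (fun h => hG.preimage (τ h).continuous)
      fun h => hd.preimage (τ h).isOpenMap
  · intro h w hw
    rw [Set.mem_iInter] at hw ⊢
    intro h'
    have := hw (h + h')
    simpa [τ, add_assoc] using this
  · intro h
    refine hc.comp (τ h).continuous.continuousOn fun w hw => ?_
    exact Set.mem_iInter.1 hw h

/-- On the cylinder of `z` of length `n`, a modification by an element of `F` lands in `D`, changes
`Θ` almost by a constant after time `K`, and the value of `Θ` up to time `K` is almost determined
by the modification alone. -/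
structure IsGoodStage {Γ H : Type*} [AddCommGroup Γ] [NormedAddCommGroup H]
    (Θ : (ℕ → Γ) → ℕ → H) (C D : Set (ℕ → Γ)) (ε : ℝ) (F : Finset (ℕ →₀ Γ)) (z : ℕ → Γ)
    (n K : ℕ) : Prop where
  mem : ∀ h ∈ F, ∀ w ∈ cylinder z n, w + ⇑h ∈ D
  tail : ∀ h ∈ F, ∀ w ∈ cylinder z n, w ∈ C → ∀ k ≥ K,
    ‖(Θ (w + ⇑h) k - Θ w k) - (Θ (w + ⇑h) K - Θ w K)‖ ≤ ε
  head : ∀ h ∈ F, ∀ w ∈ cylinder z n, w ∈ C → ∀ w' ∈ cylinder z n, w' ∈ C → ∀ k ≤ K,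
    ‖Θ (w + ⇑h) k - Θ (w' + ⇑h) k‖ ≤ ε

/-- Finite changes alter `Θ` by a convergent sequence, so the sets `A M`, where oscillation is at
most `ε` from time `M` on, cover the space. By Baire, the closure of some `A M ∩ C` has interior
inside the given cylinder; continuity at a point of `C` there gives the rest. -/
theorem exists_isGoodStage {Γ H : Type*} [AddCommGroup Γ] [TopologicalSpace Γ]
    [DiscreteTopology Γ] [Countable Γ] [NormedAddCommGroup H] {Θ : (ℕ → Γ) → ℕ → H}
    {C : Set (ℕ → Γ)} (hG : IsGδ C) (hd : Dense C) (hinv : ∀ h : ℕ →₀ Γ, ∀ w ∈ C, w + ⇑h ∈ C)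
    (hcont : ∀ h : ℕ →₀ Γ, ContinuousOn (fun w => Θ (w + ⇑h)) C)
    (hfin : ∀ (h : ℕ →₀ Γ) (w : ℕ → Γ), ∃ l, Tendsto (fun k => Θ (w + ⇑h) k - Θ w k) atTop (𝓝 l))
    {D : Set (ℕ → Γ)} (hD : IsOpen D) (hCD : C ⊆ D) {ε : ℝ} (hε : 0 < ε) (F : Finset (ℕ →₀ Γ))
    (z : ℕ → Γ) (n K : ℕ) :
    ∃ (z' : ℕ → Γ) (n' K' : ℕ), n < n' ∧ K < K' ∧ z' ∈ cylinder z n ∧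
      IsGoodStage Θ C D ε F z' n' K' := by
  have : PolishSpace Γ := inferInstance
  have hcont' : ∀ (h : ℕ →₀ Γ) (k : ℕ), ContinuousOn (fun w => Θ (w + ⇑h) k) C := fun h k =>
    (continuous_apply k).comp_continuousOn (hcont h)
  have hcont0 : ∀ (k : ℕ), ContinuousOn (fun w => Θ w k) C := fun k => by
    simpa using hcont' 0 k
  let A : ℕ → Set (ℕ → Γ) := fun M => {w | ∀ h ∈ F, ∀ k ≥ M, ∀ k' ≥ M,
    ‖(Θ (w + ⇑h) k - Θ w k) - (Θ (w + ⇑h) k' - Θ w k')‖ ≤ ε}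
  have hA : ∀ w, ∃ M, w ∈ A M := by
    intro w
    have h1 : ∀ h : ℕ →₀ Γ, ∃ M, ∀ k ≥ M, ∀ k' ≥ M,
        ‖(Θ (w + ⇑h) k - Θ w k) - (Θ (w + ⇑h) k' - Θ w k')‖ ≤ ε := by
      intro h
      obtain ⟨l, hl⟩ := hfin h w
      exact exists_norm_sub_le_of_tendsto hl hε
    choose M hM using h1
    exact ⟨F.sup M, fun h hh k hk k' hk' => hM h k ((Finset.le_sup hh).trans hk) k'
      ((Finset.le_sup hh).trans hk')⟩
  -- The condition defining `A M` is closed and all the functions in it are continuous on `C`, so it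
  -- passes to limits in `C`.
  have hcl : ∀ M, closure (A M ∩ C) ∩ C ⊆ A M := by
    rintro M w ⟨hw, hwC⟩ h hh k hk k' hk'
    have hc : ContinuousWithinAt
        (fun w => ‖(Θ (w + ⇑h) k - Θ w k) - (Θ (w + ⇑h) k' - Θ w k')‖) C w :=
      ((((hcont' h k).sub (hcont0 k)).sub ((hcont' h k').sub (hcont0 k'))).norm) w hwC
    have := mem_closure_iff_nhdsWithin_neBot.1 hw
    exact le_of_tendsto (hc.mono Set.inter_subset_right)
      (eventually_of_mem (self_mem_nhdsWithin (s := A M ∩ C)) fun w' hw' => hw'.1 h hh k hk k' hk')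
  have hdense := hG.dense_iUnion_interior_of_closed hd (f := fun M => closure (A M ∩ C))
    (fun _ => isClosed_closure) fun w hw => by
      obtain ⟨M, hM⟩ := hA w
      exact Set.mem_iUnion.2 ⟨M, subset_closure ⟨hM, hw⟩⟩
  obtain ⟨w1, hw1, hw1'⟩ := hdense.inter_open_nonempty _ (isOpen_cylinder z n)
    ⟨z, self_mem_cylinder z n⟩
  obtain ⟨M, hM⟩ := Set.mem_iUnion.1 hw1'
  obtain ⟨z', ⟨hz'1, hz'2⟩, hz'C⟩ := hd.inter_open_nonempty _
    ((isOpen_cylinder z n).inter isOpen_interior) ⟨w1, hw1, hM⟩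
  let K' := max M (K + 1)
  have ev1 : ∀ᶠ w in 𝓝 z', w ∈ interior (closure (A M ∩ C)) := isOpen_interior.mem_nhds hz'2
  have ev2 : ∀ᶠ w in 𝓝 z', ∀ h ∈ F, w + ⇑h ∈ D := by
    rw [Filter.eventually_all_finset]
    intro h _
    have hc : Continuous fun w : ℕ → Γ => w + ⇑h := by fun_prop
    exact hc.continuousAt (hD.mem_nhds (hCD (hinv h z' hz'C)))
  -- Two points of the cylinder are compared through `z'`, hence `ε / 2`.
  have ev3 : ∀ᶠ w in 𝓝 z', w ∈ C → ∀ h ∈ F, ∀ k ∈ range (K' + 1),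
      ‖Θ (w + ⇑h) k - Θ (z' + ⇑h) k‖ < ε / 2 := by
    rw [← eventually_nhdsWithin_iff, Filter.eventually_all_finset]
    intro h _
    rw [Filter.eventually_all_finset]
    intro k _
    have := ((hcont' h k).sub (continuousOn_const (c := Θ (z' + ⇑h) k))).norm z' hz'C
    refine this (gt_mem_nhds ?_)
    simpa using half_pos hε
  obtain ⟨n', hn'⟩ := exists_cylinder_subset (ev1.and (ev2.and ev3))
  have hsub : cylinder z' (max n' (n + 1)) ⊆ cylinder z' n' := fun w hw i hi =>
    hw i (lt_of_lt_of_le hi (le_max_left _ _))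
  refine ⟨z', max n' (n + 1), K', lt_of_lt_of_le (Nat.lt_succ_self n) (le_max_right _ _),
    lt_of_lt_of_le (Nat.lt_succ_self K) (le_max_right _ _), hz'1, ⟨?_, ?_, ?_⟩⟩
  · exact fun h hh w hw => (hn' (hsub hw)).2.1 h hh
  · intro h hh w hw hwC k hk
    exact hcl M ⟨interior_subset (hn' (hsub hw)).1, hwC⟩ h hh k (le_trans (le_max_left _ _) hk)
      K' (le_max_left _ _)
  · intro h hh w hw hwC w' hw' hwC' k hk
    have hk' : k ∈ range (K' + 1) := Finset.mem_range.2 (Nat.lt_succ_of_le hk)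
    have h1 := (hn' (hsub hw)).2.2 hwC h hh k hk'
    have h2 := (hn' (hsub hw')).2.2 hwC' h hh k hk'
    have h3 := norm_sub_le (Θ (w + ⇑h) k - Θ (z' + ⇑h) k) (Θ (w' + ⇑h) k - Θ (z' + ⇑h) k)
    rw [sub_sub_sub_cancel_right] at h3
    linarith

/-- Each stage handles all earlier choices at once: `F (j + 1)` contains every element of `F j`,
with and without the new change `g j` at place `N j`. -/
theorem exists_isGoodStage_sequence {Γ H : Type*} [AddCommGroup Γ] [TopologicalSpace Γ]
    [DiscreteTopology Γ] [Countable Γ] [NormedAddCommGroup H] {Θ : (ℕ → Γ) → ℕ → H}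
    {C : Set (ℕ → Γ)} (hG : IsGδ C) (hd : Dense C) (hinv : ∀ h : ℕ →₀ Γ, ∀ w ∈ C, w + ⇑h ∈ C)
    (hcont : ∀ h : ℕ →₀ Γ, ContinuousOn (fun w => Θ (w + ⇑h)) C)
    (hfin : ∀ (h : ℕ →₀ Γ) (w : ℕ → Γ), ∃ l, Tendsto (fun k => Θ (w + ⇑h) k - Θ w k) atTop (𝓝 l))
    {D : ℕ → Set (ℕ → Γ)} (hD : ∀ j, IsOpen (D j)) (hCD : C = ⋂ j, D j) {ε : ℕ → ℝ}
    (hε : ∀ j, 0 < ε j) (g : ℕ → Γ) :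
    ∃ (z : ℕ → Γ) (N K : ℕ → ℕ) (F : ℕ → Finset (ℕ →₀ Γ)), StrictMono N ∧ StrictMono K ∧
      0 ∈ F 0 ∧ (∀ j, ∀ h ∈ F j, h ∈ F (j + 1) ∧ h + Finsupp.single (N j) (g j) ∈ F (j + 1)) ∧
      ∀ j, IsGoodStage Θ C (D j) (ε j) (F j) z (N j) (K j) := by
  classical
  have step : ∀ (j : ℕ) (F : Finset (ℕ →₀ Γ)) (z : ℕ → Γ) (n K : ℕ),
      ∃ (z' : ℕ → Γ) (n' K' : ℕ), n < n' ∧ K < K' ∧ z' ∈ cylinder z n ∧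
        IsGoodStage Θ C (D j) (ε j) F z' n' K' := fun j F z n K =>
    exists_isGoodStage hG hd hinv hcont hfin (hD j) (hCD ▸ Set.iInter_subset D j) (hε j) F z n K
  choose Z n' K' hn hK hZ hgood using step
  let ext : (ℕ →₀ Γ) → Finset (ℕ →₀ Γ) → Finset (ℕ →₀ Γ) := fun d F => F ∪ F.image (· + d)
  let st : ℕ → (ℕ → Γ) × ℕ × ℕ × Finset (ℕ →₀ Γ) := fun j => Nat.rec
    (Z 0 {0} 0 0 0, n' 0 {0} 0 0 0, K' 0 {0} 0 0 0, {0})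
    (fun j s => let F := ext (Finsupp.single s.2.1 (g j)) s.2.2.2
      (Z (j + 1) F s.1 s.2.1 s.2.2.1, n' (j + 1) F s.1 s.2.1 s.2.2.1,
        K' (j + 1) F s.1 s.2.1 s.2.2.1, F)) j
  let z := fun j => (st j).1
  let N := fun j => (st j).2.1
  let K := fun j => (st j).2.2.1
  let F := fun j => (st j).2.2.2
  have hN : StrictMono N := strictMono_nat_of_lt_succ fun j => hn _ _ _ _ _
  have hKm : StrictMono K := strictMono_nat_of_lt_succ fun j => hK _ _ _ _ _
  have hz : ∀ j, z (j + 1) ∈ cylinder (z j) (N j) := fun j => hZ _ _ _ _ _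
  have hzz : ∀ j m, j ≤ m → z m ∈ cylinder (z j) (N j) := by
    intro j m hjm
    induction m, hjm using Nat.le_induction with
    | base => exact self_mem_cylinder _ _
    | succ m hm ih =>
      intro i hi
      rw [hz m i (lt_of_lt_of_le hi (hN.monotone hm)), ih i hi]
  have hF : ∀ j, F (j + 1) = ext (Finsupp.single (N j) (g j)) (F j) := fun j => rfl
  have hst : ∀ j, IsGoodStage Θ C (D j) (ε j) (F j) (z j) (N j) (K j) := by
    intro j
    cases j with
    | zero => exact hgood _ _ _ _ _
    | succ j => exact hgood _ _ _ _ _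
  -- Since `i < N (i + 1)`, coordinate `i` is frozen from stage `i + 1` on.
  let zz : ℕ → Γ := fun i => z (i + 1) i
  have hcyl : ∀ j, cylinder zz (N j) = cylinder (z j) (N j) := by
    intro j
    have : ∀ i < N j, zz i = z j i := by
      intro i hi
      have hi' : i < N (i + 1) := lt_of_lt_of_le (Nat.lt_succ_self i) (hN.id_le _)
      rcases le_total (i + 1) j with h | h
      · exact (hzz _ _ h i hi').symm
      · exact hzz _ _ h i hi
    ext w
    exact ⟨fun hw i hi => (hw i hi).trans (this i hi),
      fun hw i hi => (hw i hi).trans (this i hi).symm⟩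
  refine ⟨zz, N, K, F, hN, hKm, Finset.mem_singleton_self 0, ?_, fun j => ?_⟩
  · intro j h hh
    rw [hF]
    exact ⟨Finset.mem_union_left _ hh, Finset.mem_union_right _ (Finset.mem_image_of_mem _ hh)⟩
  · obtain ⟨h1, h2, h3⟩ := hst j
    rw [← hcyl] at h1 h2 h3
    exact ⟨h1, h2, h3⟩

/-- The sequence `z` modified at the places `N j`, `j ∈ S`, by `g j`. -/
noncomputable def modifyOn {Γ : Type*} [AddCommGroup Γ] (z : ℕ → Γ) (N : ℕ → ℕ) (g : ℕ → Γ)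
    (S : Set ℕ) : ℕ → Γ :=
  z + Function.extend N (S.indicator g) 0

theorem modifyOn_add {Γ : Type*} [AddCommGroup Γ] (z : ℕ → Γ) {N : ℕ → ℕ} (hN : StrictMono N)
    (g : ℕ → Γ) {S T R : Set ℕ} (hST : Disjoint S T) (hR : S ∪ T = R) {h : ℕ →₀ Γ}
    (hh : ⇑h = Function.extend N (T.indicator g) 0) :
    modifyOn z N g R = modifyOn z N g S + ⇑h := by
  subst hR
  rw [modifyOn, modifyOn, hh, add_assoc, Set.indicator_union_of_disjoint hST]
  congr 1
  ext i
  by_cases hi : ∃ j, N j = i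
  · obtain ⟨j, rfl⟩ := hi
    simp [hN.injective.extend_apply]
  · simp [Function.extend_apply' _ _ _ hi]

theorem modifyOn_mem_cylinder {Γ : Type*} [AddCommGroup Γ] (z : ℕ → Γ) {N : ℕ → ℕ}
    (hN : StrictMono N) (g : ℕ → Γ) {S : Set ℕ} {J : ℕ} (hS : S ⊆ Set.Ici J) :
    modifyOn z N g S ∈ cylinder z (N J) := by
  intro i hi
  rw [modifyOn, Pi.add_apply, add_eq_left]
  by_cases hi' : ∃ j, N j = i
  · obtain ⟨j, rfl⟩ := hi'
    rw [hN.injective.extend_apply, Set.indicator_of_notMem]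
    exact fun hj => absurd (hN.lt_iff_lt.1 hi) (not_lt.2 (hS hj))
  · rw [Function.extend_apply' _ _ _ hi', Pi.zero_apply]

theorem exists_mem_eq_extend {Γ : Type*} [AddCommGroup Γ] {N : ℕ → ℕ} (hN : StrictMono N)
    {g : ℕ → Γ} {F : ℕ → Finset (ℕ →₀ Γ)} (h0 : 0 ∈ F 0)
    (hF : ∀ j, ∀ h ∈ F j, h ∈ F (j + 1) ∧ h + Finsupp.single (N j) (g j) ∈ F (j + 1))
    (J : ℕ) (S : Set ℕ) :
    ∃ h ∈ F J, ⇑h = Function.extend N ((S ∩ Set.Iio J).indicator g) 0 := by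
  classical
  induction J with
  | zero =>
    refine ⟨0, h0, ?_⟩
    ext i
    by_cases hi : ∃ j, N j = i
    · obtain ⟨j, rfl⟩ := hi
      simp [hN.injective.extend_apply]
    · simp [Function.extend_apply' _ _ _ hi]
  | succ J ih =>
    obtain ⟨h, hh, he⟩ := ih
    by_cases hJ : J ∈ S
    · refine ⟨_, (hF J h hh).2, ?_⟩
      ext i
      rw [Finsupp.add_apply, he]
      by_cases hi : ∃ j, N j = i
      · obtain ⟨j, rfl⟩ := hi
        rw [hN.injective.extend_apply, hN.injective.extend_apply, Finsupp.single_apply]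
        rcases eq_or_ne J j with rfl | hne
        · simp [hJ]
        · rw [if_neg (hN.injective.ne hne), add_zero]
          have : j < J ↔ j < J + 1 := by omega
          simp [Set.indicator_apply, this]
      · have : i ≠ N J := fun h => hi ⟨J, h.symm⟩
        simp [Function.extend_apply' _ _ _ hi, this.symm]
    · refine ⟨_, (hF J h hh).1, ?_⟩
      have : S ∩ Set.Iio J = S ∩ Set.Iio (J + 1) := by
        ext j
        simp only [Set.mem_inter_iff, Set.mem_Iio, and_congr_right_iff]
        intro hj
        have : j ≠ J := fun h => hJ (h ▸ hj)
        omega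
      rw [he, this]

/-- Increments of `Θ` between consecutive times depend, up to a small error, on one coordinate. -/
theorem exists_almost_local {Γ H : Type*} [AddCommGroup Γ] [TopologicalSpace Γ]
    [DiscreteTopology Γ] [Countable Γ] [NormedAddCommGroup H] [SecondCountableTopology H]
    {Θ : (ℕ → Γ) → ℕ → H} (hΘ : @Measurable _ _ (borel (ℕ → Γ)) (borel (ℕ → H)) Θ)
    (hfin : ∀ (h : ℕ →₀ Γ) (w : ℕ → Γ), ∃ l, Tendsto (fun k => Θ (w + ⇑h) k - Θ w k) atTop (𝓝 l))
    {ε : ℕ → ℝ} (hε : ∀ j, 0 < ε j) (g : ℕ → Γ) :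
    ∃ (z : ℕ → Γ) (N K : ℕ → ℕ), StrictMono N ∧ StrictMono K ∧ ∀ (S : Set ℕ) (J k : ℕ),
      K J ≤ k → k ≤ K (J + 1) →
      ‖(Θ (modifyOn z N g S) k - Θ (modifyOn z N g S) (K J)) -
        (Θ (modifyOn z N g (S ∩ {J})) k - Θ (modifyOn z N g (S ∩ {J})) (K J))‖ ≤
      ε J + 2 * ε (J + 1) := by
  obtain ⟨C, hG, hd, hinv, hcont⟩ := exists_dense_isGδ_continuousOn_add hΘ
  obtain ⟨D, hD, hCD⟩ := isGδ_iff_eq_iInter_nat.1 hG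
  obtain ⟨z, N, K, F, hN, hK, h0, hF, hst⟩ :=
    exists_isGoodStage_sequence hG hd hinv hcont hfin hD hCD hε g
  refine ⟨z, N, K, hN, hK, ?_⟩
  have hsplit : ∀ (S : Set ℕ) (J : ℕ), ∃ h ∈ F J,
      modifyOn z N g S = modifyOn z N g (S ∩ Set.Ici J) + ⇑h := by
    intro S J
    obtain ⟨h, hh, he⟩ := exists_mem_eq_extend hN h0 hF J S
    refine ⟨h, hh, modifyOn_add z hN g ?_ ?_ he⟩
    · rw [Set.disjoint_left]
      rintro j ⟨-, h1⟩ ⟨-, h2⟩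
      exact not_lt.2 (Set.mem_Ici.1 h1) h2
    · rw [← Set.inter_union_distrib_left, Set.Ici_union_Iio, Set.inter_univ]
  have hcyl : ∀ (S : Set ℕ) (J : ℕ), modifyOn z N g (S ∩ Set.Ici J) ∈ cylinder z (N J) :=
    fun S J => modifyOn_mem_cylinder z hN g Set.inter_subset_right
  -- For each `J`, the changes before `J` form an element of `F J` and the later ones stay in the
  -- cylinder of stage `J`; hence the point lies in every `D J`.
  have hC : ∀ S : Set ℕ, modifyOn z N g S ∈ C := by
    intro S
    rw [hCD, Set.mem_iInter]
    intro J
    obtain ⟨h, hh, he⟩ := hsplit S J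
    rw [he]
    exact (hst J).mem h hh _ (hcyl S J)
  intro S J k hk hk'
  obtain ⟨h, hh, he⟩ := hsplit S J
  -- Dropping the changes before `J` alters increments after time `K J` by at most `ε J`.
  have h1 := (hst J).tail h hh _ (hcyl S J) (hC _) k hk
  rw [← he] at h1
  obtain ⟨h', hh', he'⟩ := exists_mem_eq_extend hN h0 hF (J + 1) (S ∩ {J})
  have hSJ : (S ∩ {J}) ∩ Set.Iio (J + 1) = S ∩ {J} := by
    refine Set.inter_eq_left.2 fun j hj => ?_
    rw [Set.mem_singleton_iff.1 hj.2]
    exact Nat.lt_succ_self J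
  rw [hSJ] at he'
  have e1 : modifyOn z N g (S ∩ Set.Ici J) = modifyOn z N g (S ∩ Set.Ici (J + 1)) + ⇑h' := by
    refine modifyOn_add z hN g ?_ ?_ he'
    · rw [Set.disjoint_left]
      rintro j ⟨-, h1⟩ ⟨-, h2⟩
      simp only [Set.mem_Ici, Set.mem_singleton_iff] at h1 h2
      omega
    · rw [← Set.inter_union_distrib_left]
      congr 1
      ext j; simp only [Set.mem_union, Set.mem_Ici, Set.mem_singleton_iff]; omega
  have e2 : modifyOn z N g (S ∩ {J}) = modifyOn z N g ∅ + ⇑h' :=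
    modifyOn_add z hN g (Set.empty_disjoint _) (Set.empty_union _) he'
  have hz : modifyOn z N g ∅ ∈ cylinder z (N (J + 1)) :=
    modifyOn_mem_cylinder z hN g (Set.empty_subset _)
  -- Dropping the changes after `J` alters values up to time `K (J + 1)` by at most `ε (J + 1)`;
  -- this is used at both ends of the increment.
  have h2 := (hst (J + 1)).head h' hh' _ (hcyl S (J + 1)) (hC _) _ hz (hC _)
  rw [← e1, ← e2] at h2
  have h3 := h2 k hk'
  have h4 := h2 (K J) (hK (Nat.lt_succ_self J)).le
  set a := Θ (modifyOn z N g S)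
  set b := Θ (modifyOn z N g (S ∩ Set.Ici J))
  set c := Θ (modifyOn z N g (S ∩ {J}))
  calc ‖(a k - a (K J)) - (c k - c (K J))‖
      = ‖((a k - b k) - (a (K J) - b (K J))) + ((b k - c k) - (b (K J) - c (K J)))‖ := by
        congr 1; abel
    _ ≤ ε J + (ε (J + 1) + ε (J + 1)) :=
        (norm_add_le _ _).trans (add_le_add h1 ((norm_sub_le _ _).trans (add_le_add h3 h4)))
    _ = _ := by ring

/-- A Borel reduction of a convergence relation in `G` to a convergence relation in `H` yields, for
every null sequence in `G`, a sequence in `H` with the same convergent signed subseries. -/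
theorem exists_seriesConverges_iff {Γ G H : Type*} [AddCommGroup Γ] [TopologicalSpace Γ]
    [DiscreteTopology Γ] [Countable Γ] [NormedAddCommGroup G] [NormedSpace ℝ G] [CompleteSpace G]
    [NormedAddCommGroup H] [NormedSpace ℝ H] [CompleteSpace H] [SecondCountableTopology H]
    (w : Γ →+ G) {Θ : (ℕ → Γ) → ℕ → H}
    (hΘ : @Measurable _ _ (borel (ℕ → Γ)) (borel (ℕ → H)) Θ)
    (hred : ∀ x y, SeriesConverges (fun i => w (x i - y i)) ↔
      ∃ l, Tendsto (fun k => Θ x k - Θ y k) atTop (𝓝 l))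
    (g : ℕ → Γ) (hg : Tendsto (fun j => w (g j)) atTop (𝓝 0)) (S : AddSubgroup H)
    (hS : ∀ x k, Θ x k ∈ S) :
    ∃ u : ℕ → H, (∀ j, u j ∈ S) ∧ ∀ ε : ℕ → ℝ, (∀ j, ε j = -1 ∨ ε j = 0 ∨ ε j = 1) →
      (SeriesConverges (fun j => ε j • w (g j)) ↔ SeriesConverges (fun j => ε j • u j)) := by
  have hfin : ∀ (h : ℕ →₀ Γ) (x : ℕ → Γ),
      ∃ l, Tendsto (fun k => Θ (x + ⇑h) k - Θ x k) atTop (𝓝 l) := by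
    intro h x
    rw [← hred]
    refine SeriesConverges.of_summable (summable_of_hasFiniteSupport (h.hasFiniteSupport.subset ?_))
    intro i hi h0
    simp only [Pi.add_apply, add_sub_cancel_left, Function.mem_support] at hi
    exact hi (by rw [h0, map_zero])
  obtain ⟨z, N, K, hN, hK, hloc⟩ := exists_almost_local hΘ hfin
    (ε := fun j => (1 / 2) ^ j) (fun j => by positivity) g
  let e := modifyOn z N g
  -- The effect of the single change `g J` on the increment of `Θ` since time `K J`.
  let U : ℕ → ℕ → H := fun J k => (Θ (e {J}) k - Θ (e {J}) (K J)) - (Θ (e ∅) k - Θ (e ∅) (K J))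
  let b : ℕ → ℝ := fun J => 4 * (1 / 2) ^ J
  have hb : Summable b := summable_half_pow.mul_left 4
  have hb0 : Tendsto b atTop (𝓝 0) := hb.tendsto_atTop_zero
  -- Signs are realised by comparing two modifications, one for the places with sign `1` and one for
  -- those with sign `-1`.
  let d : (ℕ → ℝ) → ℕ → H := fun ε k => Θ (e {j | ε j = 1}) k - Θ (e {j | ε j = -1}) k
  have hd : ∀ ε : ℕ → ℝ, (∀ j, ε j = -1 ∨ ε j = 0 ∨ ε j = 1) → ∀ J k, K J ≤ k → k ≤ K (J + 1) →
      ‖d ε k - d ε (K J) - ε J • U J k‖ ≤ b J := by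
    intro ε hε J k h1 h2
    have h3 := hloc {j | ε j = 1} J k h1 h2
    have h4 := hloc {j | ε j = -1} J k h1 h2
    have key : ε J • U J k =
        (Θ (e ({j | ε j = 1} ∩ {J})) k - Θ (e ({j | ε j = 1} ∩ {J})) (K J)) -
        (Θ (e ({j | ε j = -1} ∩ {J})) k - Θ (e ({j | ε j = -1} ∩ {J})) (K J)) := by
      have hin : ∀ a : ℝ, ε J = a → {j | ε j = a} ∩ {J} = {J} := fun a ha => by
        ext j; simp only [Set.mem_inter_iff, Set.mem_ofPred_eq, Set.mem_singleton_iff]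
        exact ⟨fun h => h.2, fun h => ⟨h ▸ ha, h⟩⟩
      have hout : ∀ a : ℝ, ε J ≠ a → {j | ε j = a} ∩ {J} = ∅ := fun a ha => by
        ext j; simp only [Set.mem_inter_iff, Set.mem_ofPred_eq, Set.mem_singleton_iff,
          Set.mem_empty_iff_false, iff_false]
        exact fun h => ha (h.2 ▸ h.1)
      rcases hε J with h | h | h
      · rw [hin (-1) h, hout 1 (by rw [h]; norm_num), h, neg_one_smul]
        simp only [U]; abel
      · rw [hout (-1) (by rw [h]; norm_num), hout 1 (by rw [h]; norm_num), h, zero_smul, sub_self]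
      · rw [hin 1 h, hout (-1) (by rw [h]; norm_num), h, one_smul]
    rw [key]
    have := norm_sub_le_of_le h3 h4
    refine le_trans (le_of_eq ?_) (this.trans (le_of_eq ?_))
    · congr 1; simp only [d, e]; abel
    · simp only [b]; ring
  have hG : ∀ ε : ℕ → ℝ, (∀ j, ε j = -1 ∨ ε j = 0 ∨ ε j = 1) →
      (SeriesConverges (fun j => ε j • w (g j)) ↔ ∃ l, Tendsto (d ε) atTop (𝓝 l)) := by
    intro ε hε
    rw [← hred, ← seriesConverges_extend hN]
    refine iff_of_eq (congrArg _ (funext fun i => ?_))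
    simp only [e, modifyOn, Pi.add_apply, add_sub_add_left_eq_sub]
    by_cases hi : ∃ j, N j = i
    · obtain ⟨j, rfl⟩ := hi
      simp only [hN.injective.extend_apply]
      rcases hε j with h | h | h <;> simp [Set.indicator_apply, h] <;> norm_num
    · simp [Function.extend_apply' _ _ _ hi]
  -- Otherwise large values of `U` occur in infinitely many blocks. Keeping a sparse set of these
  -- makes the source series absolutely convergent, so `d` converges, yet it oscillates by more than
  -- `δ / 2` in late blocks.
  have hU : ∀ δ > 0, ∃ J₀, ∀ J ≥ J₀, ∀ k, K J ≤ k → k ≤ K (J + 1) → ‖U J k‖ ≤ δ := by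
    intro δ hδ
    by_contra! hcon
    have hfreq : ∃ᶠ J in atTop, ∃ k, K J ≤ k ∧ k ≤ K (J + 1) ∧ δ < ‖U J k‖ :=
      frequently_atTop.2 hcon
    obtain ⟨φ, hφ, hφ'⟩ := exists_strictMono_le_pow (by simpa using hg.norm) hfreq
    let ε : ℕ → ℝ := Function.extend φ 1 0
    have hφe : ∀ n, ε (φ n) = 1 := fun n => hφ.injective.extend_apply _ _ n
    have hε : ∀ j, ε j = -1 ∨ ε j = 0 ∨ ε j = 1 := by
      intro j
      by_cases hj : ∃ n, φ n = j
      · obtain ⟨n, rfl⟩ := hj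
        exact Or.inr (Or.inr (hφe n))
      · exact Or.inr (Or.inl (Function.extend_apply' _ _ _ hj))
    have hconv : SeriesConverges (fun j => ε j • w (g j)) := by
      have : (fun j => ε j • w (g j)) = Function.extend φ (fun n => w (g (φ n))) 0 := by
        ext j
        by_cases hj : ∃ n, φ n = j
        · obtain ⟨n, rfl⟩ := hj
          rw [hφe, hφ.injective.extend_apply, one_smul]
        · simp [ε, Function.extend_apply' _ _ _ hj]
      rw [this, seriesConverges_extend hφ]
      exact SeriesConverges.of_summable
        (Summable.of_norm_bounded summable_half_pow fun n => (hφ' n).2)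
    obtain ⟨l, hl⟩ := (hG ε hε).1 hconv
    obtain ⟨J₁, hJ₁⟩ := exists_norm_sub_le_of_tendsto hl (half_pos hδ)
    obtain ⟨J₂, hJ₂⟩ := (hb0.eventually (gt_mem_nhds (half_pos hδ))).exists_forall_of_atTop
    let n := max J₁ J₂
    obtain ⟨k, hk1, hk2, hk3⟩ := (hφ' n).1
    have hnK : n ≤ K (φ n) := (hφ.id_le n).trans (hK.id_le _)
    have h1 := hd ε hε (φ n) k hk1 hk2
    have h2 := hJ₂ (φ n) ((le_max_right _ _).trans (hφ.id_le n))
    have h3 := hJ₁ k ((le_max_left _ _).trans (hnK.trans hk1)) (K (φ n))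
      ((le_max_left _ _).trans hnK)
    rw [hφe, one_smul, norm_sub_rev] at h1
    have h4 := norm_sub_norm_le (U (φ n) k) (d ε k - d ε (K (φ n)))
    linarith
  refine ⟨fun J => U J (K (J + 1)), fun J => ?_, fun ε hε => ?_⟩
  · exact S.sub_mem (S.sub_mem (hS _ _) (hS _ _)) (S.sub_mem (hS _ _) (hS _ _))
  rw [hG ε hε]
  have hstep : ∀ J, ‖(d ε (K (J + 1)) - d ε (K J)) - ε J • U J (K (J + 1))‖ ≤ b J := fun J =>
    hd ε hε J _ (hK (Nat.lt_succ_self J)).le le_rfl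
  rw [← seriesConverges_iff_of_norm_sub_le hb hstep]
  have hsum : ∀ n, ∑ J ∈ range n, (d ε (K (J + 1)) - d ε (K J)) = d ε (K n) - d ε (K 0) :=
    fun n => Finset.sum_range_sub (fun J => d ε (K J)) n
  simp only [SeriesConverges, hsum]
  constructor
  · rintro ⟨l, hl⟩
    exact ⟨_, (hl.comp hK.tendsto_atTop).sub_const _⟩
  · rintro ⟨l, hl⟩
    refine ⟨l + d ε (K 0), tendsto_of_tendsto_block hK (by simpa using hl.add_const (d ε (K 0))) ?_⟩
    intro δ hδ
    obtain ⟨J₁, hJ₁⟩ := hU (δ / 2) (half_pos hδ)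
    obtain ⟨J₂, hJ₂⟩ := (hb0.eventually (gt_mem_nhds (half_pos hδ))).exists_forall_of_atTop
    refine ⟨max J₁ J₂, fun J hJ k hk hk' => ?_⟩
    have h1 := hd ε hε J k hk hk'.le
    have h2 := hJ₁ J ((le_max_left _ _).trans hJ) k hk hk'.le
    have h3 := hJ₂ J ((le_max_right _ _).trans hJ)
    have h4 : ‖ε J • U J k‖ ≤ ‖U J k‖ := by
      rcases hε J with h | h | h <;> simp [h]
    have h5 := norm_sub_norm_le (d ε k - d ε (K J)) (ε J • U J k)
    linarith

/-! ### From signed subseries to dyadic coefficients -/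

/-- `V` and `v` have the same convergent series with signed dyadic null coefficients, where the
`i`-th coefficient is a multiple of `2⁻ⁱ`. -/
def DyadicEquiv {G H : Type*} [NormedAddCommGroup G] [NormedSpace ℝ G] [NormedAddCommGroup H]
    [NormedSpace ℝ H] (V : ℕ → G) (v : ℕ → H) : Prop :=
  ∀ (r : ℕ → ℕ) (ε : ℕ → ℝ), (∀ i, r i ≤ i) → Tendsto r atTop atTop →
    (∀ i, ε i = -1 ∨ ε i = 0 ∨ ε i = 1) →
    (SeriesConverges (fun i => (ε i * (1 / 2) ^ r i) • V i) ↔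
      SeriesConverges (fun i => (ε i * (1 / 2) ^ r i) • v i))

/-- Indicator of the residue class of `c` modulo `2 ^ r`. -/
noncomputable def residueIndicator (r c j : ℕ) : ℝ := if j % 2 ^ r = c then 1 else 0

/-- As `2 ^ r` divides `2 ^ m`, the block starts at residue `0`. Partial counts of two classes
therefore differ by at most one. -/
theorem sum_residueIndicator {m r c n : ℕ} (hr : r ≤ m) (hc : c < 2 ^ r) :
    ∑ j ∈ Finset.Ico (2 ^ m) n, residueIndicator r c j =
      (((n - 2 ^ m) / 2 ^ r : ℕ) : ℝ) + if c < (n - 2 ^ m) % 2 ^ r then 1 else 0 := by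
  rw [Finset.sum_Ico_eq_sum_range]
  have h1 : ∀ i, residueIndicator r c (2 ^ m + i) = if i ≡ c [MOD 2 ^ r] then 1 else 0 := by
    intro i
    obtain ⟨d, hd⟩ := pow_dvd_pow 2 hr
    simp only [residueIndicator, hd, Nat.mul_add_mod, Nat.ModEq, Nat.mod_eq_of_lt hc]
  simp only [h1]
  rw [Finset.sum_boole, ← Nat.count_eq_card_filter_range,
    Nat.count_modEq_card _ (by positivity), Nat.mod_eq_of_lt hc]
  push_cast
  rfl

theorem log_eq_of_mem_Ico {m n j : ℕ} (hn : n ≤ 2 ^ (m + 1)) (hj : j ∈ Finset.Ico (2 ^ m) n) :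
    Nat.log 2 j = m := by
  rw [Finset.mem_Ico] at hj
  exact Nat.log_eq_of_pow_le_of_lt_pow hj.1 (lt_of_lt_of_le hj.2 hn)

theorem strictMono_two_pow : StrictMono (fun m : ℕ => 2 ^ m) :=
  pow_right_strictMono₀ (by norm_num)

theorem sum_residueIndicator_block {m r c : ℕ} (hr : r ≤ m) (hc : c < 2 ^ r) :
    ∑ j ∈ Finset.Ico (2 ^ m) (2 ^ (m + 1)), residueIndicator r c j = 2 ^ (m - r) := by
  rw [sum_residueIndicator hr hc]
  have h1 : 2 ^ (m + 1) - 2 ^ m = 2 ^ m := by rw [pow_succ]; omega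
  rw [h1, Nat.pow_div hr (by norm_num), Nat.mod_eq_zero_of_dvd (pow_dvd_pow 2 hr)]
  simp

theorem residueIndicator_nonneg (r c j : ℕ) : 0 ≤ residueIndicator r c j := by
  unfold residueIndicator; split_ifs <;> norm_num

section Blocks

variable {G H : Type*} [NormedAddCommGroup G] [NormedSpace ℝ G] [NormedAddCommGroup H]
  [NormedSpace ℝ H]

/-- Sum of `u` over a residue class modulo `2 ^ r` in the block `[2 ^ m, 2 ^ (m + 1))`. -/
noncomputable def residueSum (u : ℕ → H) (m r c : ℕ) : H :=
  ∑ j ∈ Finset.Ico (2 ^ m) (2 ^ (m + 1)), residueIndicator r c j • u j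

/-- On the block `[2 ^ m, 2 ^ (m + 1))` the logarithm is constantly `m`, so the same vector `2⁻ᵐ V
m` is repeated. -/
theorem sum_smul_dyadic (V : ℕ → G) (ε : ℕ → ℝ) {m n : ℕ} (hn : n ≤ 2 ^ (m + 1)) :
    ∑ j ∈ Finset.Ico (2 ^ m) n, ε j • (((1 : ℝ) / 2) ^ Nat.log 2 j • V (Nat.log 2 j)) =
      (∑ j ∈ Finset.Ico (2 ^ m) n, ε j) • (((1 : ℝ) / 2) ^ m • V m) := by
  rw [Finset.sum_smul]
  refine Finset.sum_congr rfl fun j hj => ?_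
  rw [log_eq_of_mem_Ico hn hj]

theorem residueSum_zero_eq_sum (u : ℕ → H) (m r : ℕ) :
    residueSum u m 0 0 = ∑ c ∈ range (2 ^ r), residueSum u m r c := by
  simp only [residueSum]
  rw [Finset.sum_comm]
  refine Finset.sum_congr rfl fun j _ => ?_
  rw [← Finset.sum_smul]
  congr 1
  simp only [residueIndicator]
  rw [Finset.sum_ite_eq, if_pos (Finset.mem_range.2 (Nat.mod_lt _ (by positivity)))]
  simp [Nat.mod_one]

/-- The block sum is the sum of its `2 ^ r` class sums, so `2⁻ʳ` times it is their average. -/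
theorem norm_smul_residueSum_sub_le {u : ℕ → H} {m r : ℕ} {δ : ℝ}
    (h : ∀ c < 2 ^ r, ‖residueSum u m r c - residueSum u m r 0‖ ≤ δ) :
    ‖((1 : ℝ) / 2) ^ r • residueSum u m 0 0 - residueSum u m r 0‖ ≤ δ := by
  have h1 : ((1 : ℝ) / 2) ^ r • residueSum u m 0 0 - residueSum u m r 0 =
      ((1 : ℝ) / 2) ^ r • ∑ c ∈ range (2 ^ r), (residueSum u m r c - residueSum u m r 0) := by
    rw [Finset.sum_sub_distrib, smul_sub, ← residueSum_zero_eq_sum]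
    congr 1
    rw [Finset.sum_const, Finset.card_range, ← Nat.cast_smul_eq_nsmul ℝ, smul_smul]
    push_cast
    rw [← mul_pow]
    norm_num
  rw [h1, norm_smul]
  have h2 := norm_sum_le_of_le (range (2 ^ r)) fun c hc => h c (Finset.mem_range.1 hc)
  rw [Finset.sum_const, Finset.card_range, nsmul_eq_mul] at h2
  calc _ ≤ ‖((1 : ℝ) / 2) ^ r‖ * (((2 ^ r : ℕ) : ℝ) * δ) := by gcongr
    _ = (1 / 2 * 2) ^ r * δ := by rw [norm_pow, mul_pow]; push_cast; norm_num; ring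
    _ = δ := by norm_num

/-- Sums over residue classes of the same modulus are almost equal. -/
theorem exists_norm_residueSum_sub_le {V : ℕ → G} (hV : ∀ m, ‖V m‖ ≤ 1) {u : ℕ → H}
    (hu : ∀ ε : ℕ → ℝ, (∀ j, ε j = -1 ∨ ε j = 0 ∨ ε j = 1) →
      SeriesConverges (fun j => ε j • (((1 : ℝ) / 2) ^ Nat.log 2 j • V (Nat.log 2 j))) →
      SeriesConverges (fun j => ε j • u j)) {δ : ℝ} (hδ : 0 < δ) :
    ∃ M, ∀ m ≥ M, ∀ r ≤ m, ∀ c < 2 ^ r, ∀ c' < 2 ^ r,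
      ‖residueSum u m r c - residueSum u m r c'‖ ≤ δ := by
  by_contra! hcon
  -- A bad triple is chosen in each block that has one; the default `0, 0, 0` makes the signs below
  -- vanish.
  have hsel : ∀ m, ∃ r c c' : ℕ, r ≤ m ∧ c < 2 ^ r ∧ c' < 2 ^ r ∧
      ((∃ r ≤ m, ∃ c < 2 ^ r, ∃ c' < 2 ^ r, δ < ‖residueSum u m r c - residueSum u m r c'‖) →
        δ < ‖residueSum u m r c - residueSum u m r c'‖) := by
    intro m
    by_cases h : ∃ r ≤ m, ∃ c < 2 ^ r, ∃ c' < 2 ^ r,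
      δ < ‖residueSum u m r c - residueSum u m r c'‖
    · obtain ⟨r, hr, c, hc, c', hc', h'⟩ := h
      exact ⟨r, c, c', hr, hc, hc', fun _ => h'⟩
    · exact ⟨0, 0, 0, Nat.zero_le _, by norm_num, by norm_num, fun h' => absurd h' h⟩
  choose R C C' hR hC hC' hsel using hsel
  -- Class `C` gets `+1` and class `C'` gets `-1`. The classes interleave, so partial sums in a
  -- block stay in `[-1, 1]` and cancel at its end: the source series converges, but the target
  -- series has large block sums.
  let ε : ℕ → ℝ := fun j => residueIndicator (R (Nat.log 2 j)) (C (Nat.log 2 j)) j -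
    residueIndicator (R (Nat.log 2 j)) (C' (Nat.log 2 j)) j
  have hε : ∀ j, ε j = -1 ∨ ε j = 0 ∨ ε j = 1 := by
    intro j
    simp only [ε, residueIndicator]
    split_ifs <;> norm_num
  have hblock : ∀ m n, n ≤ 2 ^ (m + 1) → ∀ j ∈ Finset.Ico (2 ^ m) n,
      ε j = residueIndicator (R m) (C m) j - residueIndicator (R m) (C' m) j := by
    intro m n hn j hj
    simp only [ε, log_eq_of_mem_Ico hn hj]
  have hsum : ∀ m n, n ≤ 2 ^ (m + 1) → |∑ j ∈ Finset.Ico (2 ^ m) n, ε j| ≤ 1 := by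
    intro m n h2
    rw [Finset.sum_congr rfl (hblock m n h2), Finset.sum_sub_distrib,
      sum_residueIndicator (hR m) (hC m), sum_residueIndicator (hR m) (hC' m),
      add_sub_add_left_eq_sub]
    split_ifs <;> norm_num
  have hsum0 : ∀ m, ∑ j ∈ Finset.Ico (2 ^ m) (2 ^ (m + 1)), ε j = 0 := by
    intro m
    rw [Finset.sum_congr rfl (hblock m _ le_rfl), Finset.sum_sub_distrib,
      sum_residueIndicator_block (hR m) (hC m), sum_residueIndicator_block (hR m) (hC' m), sub_self]
  have hconv : SeriesConverges
      (fun j => ε j • (((1 : ℝ) / 2) ^ Nat.log 2 j • V (Nat.log 2 j))) := by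
    refine SeriesConverges.of_block strictMono_two_pow ?_ ?_
    · refine ⟨0, ?_⟩
      simp only [sum_smul_dyadic V ε le_rfl, hsum0, zero_smul, Finset.sum_const_zero]
      exact tendsto_const_nhds
    · intro δ' hδ'
      obtain ⟨J, hJ⟩ := exists_pow_lt_of_lt_one hδ' (by norm_num : (1 : ℝ) / 2 < 1)
      refine ⟨J, fun m hm n _ h2 => ?_⟩
      rw [sum_smul_dyadic V ε h2.le, norm_smul, norm_smul, norm_pow]
      have h3 : ‖(1 : ℝ) / 2‖ ^ m ≤ (1 / 2) ^ J := by
        rw [Real.norm_of_nonneg (by norm_num)]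
        exact pow_le_pow_of_le_one (by norm_num) (by norm_num) hm
      calc _ ≤ 1 * ((1 / 2) ^ J * 1) :=
            mul_le_mul (hsum m n h2.le) (mul_le_mul h3 (hV m) (norm_nonneg _) (by positivity))
              (by positivity) (by norm_num)
        _ ≤ δ' := by linarith
  obtain ⟨J, hJ⟩ := (hu ε hε hconv).exists_norm_sum_Ico_le hδ
  obtain ⟨m, hm, hbad⟩ := hcon J
  have h1 := hJ (2 ^ m) (hm.le.trans Nat.lt_two_pow_self.le) (2 ^ (m + 1))
    (pow_le_pow_right₀ (by norm_num) (Nat.le_succ m))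
  have h2 := hsel m hbad
  rw [residueSum, residueSum, ← Finset.sum_sub_distrib] at h2
  simp only [← sub_smul] at h2
  have h3 : ∑ j ∈ Finset.Ico (2 ^ m) (2 ^ (m + 1)), ε j • u j =
      ∑ j ∈ Finset.Ico (2 ^ m) (2 ^ (m + 1)),
        (residueIndicator (R m) (C m) j - residueIndicator (R m) (C' m) j) • u j :=
    Finset.sum_congr rfl fun j hj => by rw [hblock m _ le_rfl j hj]
  rw [h3] at h1
  linarith

end Blocks

section

variable {G H : Type*} [NormedAddCommGroup G] [NormedSpace ℝ G] [NormedAddCommGroup H]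
  [NormedSpace ℝ H]

/-- Signs that select the residue class of `0` modulo `2 ^ r i` in the block number `μ i`, with the
sign `ε i`. -/
noncomputable def blockSign (μ r : ℕ → ℕ) (ε : ℕ → ℝ) (j : ℕ) : ℝ :=
  Function.extend μ (fun i => ε i * residueIndicator (r i) 0 j) 0 (Nat.log 2 j)

theorem blockSign_mem {μ r : ℕ → ℕ} {ε : ℕ → ℝ} (hμ : StrictMono μ)
    (hε : ∀ i, ε i = -1 ∨ ε i = 0 ∨ ε i = 1) (j : ℕ) :
    blockSign μ r ε j = -1 ∨ blockSign μ r ε j = 0 ∨ blockSign μ r ε j = 1 := by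
  rw [blockSign]
  by_cases hj : ∃ i, μ i = Nat.log 2 j
  · obtain ⟨i, hi⟩ := hj
    rw [← hi, hμ.injective.extend_apply, residueIndicator]
    split_ifs
    · simpa using hε i
    · simp
  · rw [Function.extend_apply' _ _ _ hj]
    simp

theorem sum_blockSign_smul {μ r : ℕ → ℕ} {ε : ℕ → ℝ} (hμ : StrictMono μ) (u : ℕ → H) {i n : ℕ}
    (hn : n ≤ 2 ^ (μ i + 1)) :
    ∑ j ∈ Finset.Ico (2 ^ μ i) n, blockSign μ r ε j • u j =
      ε i • ∑ j ∈ Finset.Ico (2 ^ μ i) n, residueIndicator (r i) 0 j • u j := by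
  rw [Finset.smul_sum]
  refine Finset.sum_congr rfl fun j hj => ?_
  rw [blockSign, log_eq_of_mem_Ico hn hj, hμ.injective.extend_apply, mul_smul]

theorem sum_blockSign_smul_of_notMem {μ r : ℕ → ℕ} {ε : ℕ → ℝ} (u : ℕ → H) {m n : ℕ}
    (hm : ¬ ∃ i, μ i = m) (hn : n ≤ 2 ^ (m + 1)) :
    ∑ j ∈ Finset.Ico (2 ^ m) n, blockSign μ r ε j • u j = 0 := by
  refine Finset.sum_eq_zero fun j hj => ?_
  rw [blockSign, log_eq_of_mem_Ico hn hj, Function.extend_apply' _ _ _ hm, Pi.zero_apply, zero_smul]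

theorem block_sum_blockSign_smul {μ r : ℕ → ℕ} {ε : ℕ → ℝ} (hμ : StrictMono μ) (u : ℕ → H) :
    (fun m => ∑ j ∈ Finset.Ico (2 ^ m) (2 ^ (m + 1)), blockSign μ r ε j • u j) =
      Function.extend μ (fun i => ε i • residueSum u (μ i) (r i) 0) 0 := by
  ext m
  by_cases hm : ∃ i, μ i = m
  · obtain ⟨i, rfl⟩ := hm
    rw [hμ.injective.extend_apply, sum_blockSign_smul hμ u le_rfl, residueSum]
  · rw [Function.extend_apply' _ _ _ hm, sum_blockSign_smul_of_notMem u hm le_rfl, Pi.zero_apply]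

theorem seriesConverges_blockSign_of {μ r : ℕ → ℕ} {ε : ℕ → ℝ} (hμ : StrictMono μ)
    (hε : ∀ i, ε i = -1 ∨ ε i = 0 ∨ ε i = 1) {u : ℕ → H}
    (h : SeriesConverges (fun i => ε i • residueSum u (μ i) (r i) 0))
    (hosc : ∀ δ > 0, ∃ I, ∀ i ≥ I, ∀ n, 2 ^ μ i ≤ n → n < 2 ^ (μ i + 1) →
      ‖∑ j ∈ Finset.Ico (2 ^ μ i) n, residueIndicator (r i) 0 j • u j‖ ≤ δ) :
    SeriesConverges (fun j => blockSign μ r ε j • u j) := by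
  refine SeriesConverges.of_block strictMono_two_pow ?_ ?_
  · rw [block_sum_blockSign_smul hμ]
    exact (seriesConverges_extend hμ _).2 h
  · intro δ hδ
    obtain ⟨I, hI⟩ := hosc δ hδ
    refine ⟨μ I, fun m hm n h1 h2 => ?_⟩
    by_cases hm' : ∃ i, μ i = m
    · obtain ⟨i, rfl⟩ := hm'
      rw [sum_blockSign_smul hμ u h2.le]
      refine le_trans ?_ (hI i (hμ.le_iff_le.1 hm) n h1 h2)
      rcases hε i with h | h | h <;> simp [h]
    · rw [sum_blockSign_smul_of_notMem u hm' h2.le, norm_zero]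
      exact hδ.le

theorem SeriesConverges.of_blockSign {μ r : ℕ → ℕ} {ε : ℕ → ℝ} (hμ : StrictMono μ) {u : ℕ → H}
    (h : SeriesConverges (fun j => blockSign μ r ε j • u j)) :
    SeriesConverges (fun i => ε i • residueSum u (μ i) (r i) 0) := by
  have := h.block strictMono_two_pow
  rw [block_sum_blockSign_smul hμ] at this
  exact (seriesConverges_extend hμ _).1 this

/-- The class of `0` has `2 ^ (m - r)` places in the block, each carrying `2⁻ᵐ V m`; this is how
signs produce the coefficient `2⁻ʳ`. -/
theorem residueSum_dyadic (V : ℕ → G) {m r : ℕ} (hr : r ≤ m) :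
    residueSum (fun j => ((1 : ℝ) / 2) ^ Nat.log 2 j • V (Nat.log 2 j)) m r 0 =
      ((1 : ℝ) / 2) ^ r • V m := by
  rw [residueSum, sum_smul_dyadic V _ le_rfl, sum_residueIndicator_block hr (by positivity),
    smul_smul]
  congr 1
  obtain ⟨d, rfl⟩ := Nat.exists_eq_add_of_le hr
  rw [Nat.add_sub_cancel_left, pow_add, mul_left_comm, ← mul_pow]
  norm_num

theorem norm_sum_residueIndicator_dyadic_le {V : ℕ → G} (hV : ∀ m, ‖V m‖ ≤ 1) {m r n : ℕ}
    (hr : r ≤ m) (hn : n ≤ 2 ^ (m + 1)) :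
    ‖∑ j ∈ Finset.Ico (2 ^ m) n, residueIndicator r 0 j •
      (((1 : ℝ) / 2) ^ Nat.log 2 j • V (Nat.log 2 j))‖ ≤ (1 / 2) ^ r := by
  rw [sum_smul_dyadic V _ hn, norm_smul, norm_smul, norm_pow, Real.norm_of_nonneg (Finset.sum_nonneg
    fun j _ => residueIndicator_nonneg r 0 j), Real.norm_of_nonneg (by norm_num : (0 : ℝ) ≤ 1 / 2)]
  have h1 : ∑ j ∈ Finset.Ico (2 ^ m) n, residueIndicator r 0 j ≤ 2 ^ (m - r) := by
    rw [← sum_residueIndicator_block (c := 0) hr (by positivity)]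
    exact Finset.sum_le_sum_of_subset_of_nonneg (Finset.Ico_subset_Ico le_rfl hn)
      fun j _ _ => residueIndicator_nonneg r 0 j
  calc _ ≤ 2 ^ (m - r) * (((1 : ℝ) / 2) ^ m * 1) := by
        gcongr
        exact hV m
    _ = (1 / 2) ^ r := by
      obtain ⟨d, rfl⟩ := Nat.exists_eq_add_of_le hr
      rw [Nat.add_sub_cancel_left, pow_add, mul_one, mul_left_comm, ← mul_pow]
      norm_num

/-- If all signed subseries of `2⁻ᵐ V_m`, each term repeated `2 ^ m` times, converge together with
those of `u`, then `V` is dyadically equivalent, along a subsequence, to a sequence in `H`. -/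
theorem exists_dyadicEquiv [CompleteSpace G] [CompleteSpace H] {V : ℕ → G} (hV : ∀ m, ‖V m‖ ≤ 1)
    {u : ℕ → H} (hu : ∀ ε : ℕ → ℝ, (∀ j, ε j = -1 ∨ ε j = 0 ∨ ε j = 1) →
      (SeriesConverges (fun j => ε j • (((1 : ℝ) / 2) ^ Nat.log 2 j • V (Nat.log 2 j))) ↔
      SeriesConverges (fun j => ε j • u j))) (S : AddSubgroup H) (hS : ∀ j, u j ∈ S) :
    ∃ (μ : ℕ → ℕ) (v : ℕ → H), StrictMono μ ∧ DyadicEquiv (fun i => V (μ i)) v ∧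
      ∀ i, ∀ r ≤ i, ∃ s ∈ S, ‖((1 : ℝ) / 2) ^ r • v i - s‖ ≤ (1 / 2) ^ i := by
  have hSr : ∀ m r c, residueSum u m r c ∈ S := fun m r c => by
    refine S.sum_mem fun j _ => ?_
    unfold residueIndicator
    split_ifs
    · simpa using hS j
    · simp
  -- Sparse blocks make the class discrepancies summable.
  obtain ⟨μ, hμ, hμ'⟩ := extraction_forall_of_eventually'
    (P := fun i m => ∀ r ≤ m, ∀ c < 2 ^ r, ∀ c' < 2 ^ r,
      ‖residueSum u m r c - residueSum u m r c'‖ ≤ (1 / 2) ^ i)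
    fun i => exists_norm_residueSum_sub_le hV (fun ε hε => (hu ε hε).1) (by positivity)
  have happrox : ∀ i, ∀ r ≤ i, ‖((1 : ℝ) / 2) ^ r • residueSum u (μ i) 0 0 -
      residueSum u (μ i) r 0‖ ≤ (1 / 2) ^ i := fun i r hr =>
    norm_smul_residueSum_sub_le fun c hc =>
      hμ' i r (hr.trans (hμ.id_le i)) c hc 0 (by positivity)
  -- The vector `v i` is the whole block sum, with modulus `2 ^ 0`.
  refine ⟨μ, fun i => residueSum u (μ i) 0 0, hμ, ?_, fun i r hr => ⟨_, hSr _ _ _, happrox i r hr⟩⟩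
  intro r ε hr hrt hε
  have hr' : ∀ i, r i ≤ μ i := fun i => (hr i).trans (hμ.id_le i)
  have hpow : Tendsto (fun i => ((1 : ℝ) / 2) ^ r i) atTop (𝓝 0) :=
    (tendsto_pow_atTop_nhds_zero_of_lt_one (by norm_num) (by norm_num)).comp hrt
  have hG : ∀ ε : ℕ → ℝ, (∀ i, ε i = -1 ∨ ε i = 0 ∨ ε i = 1) →
      (SeriesConverges (fun i => (ε i * (1 / 2) ^ r i) • V (μ i)) ↔
        SeriesConverges (fun j => blockSign μ r ε j • u j)) := by
    intro ε hε
    rw [← hu _ (blockSign_mem hμ hε)]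
    have h1 : (fun i => (ε i * (1 / 2) ^ r i) • V (μ i)) = fun i => ε i • residueSum
        (fun j => ((1 : ℝ) / 2) ^ Nat.log 2 j • V (Nat.log 2 j)) (μ i) (r i) 0 :=
      funext fun i => by rw [residueSum_dyadic V (hr' i), smul_smul]
    rw [h1]
    refine ⟨fun h => seriesConverges_blockSign_of hμ hε h ?_, fun h => h.of_blockSign hμ⟩
    intro δ hδ
    obtain ⟨I, hI⟩ := (hpow.eventually (gt_mem_nhds hδ)).exists_forall_of_atTop
    exact ⟨I, fun i hi n _ h2 =>
      (norm_sum_residueIndicator_dyadic_le hV (hr' i) h2.le).trans (hI i hi).le⟩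
  -- If partial sums inside blocks were large infinitely often, a sparse choice of such blocks would
  -- give an absolutely convergent source series and a non-Cauchy target series.
  have hosc : ∀ δ > 0, ∃ I, ∀ i ≥ I, ∀ n, 2 ^ μ i ≤ n → n < 2 ^ (μ i + 1) →
      ‖∑ j ∈ Finset.Ico (2 ^ μ i) n, residueIndicator (r i) 0 j • u j‖ ≤ δ := by
    intro δ hδ
    by_contra! hcon
    obtain ⟨φ, hφ, hφ'⟩ := exists_strictMono_le_pow hpow (frequently_atTop.2 hcon)
    let ε : ℕ → ℝ := Function.extend φ 1 0
    have hφe : ∀ n, ε (φ n) = 1 := fun n => hφ.injective.extend_apply _ _ n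
    have hε : ∀ j, ε j = -1 ∨ ε j = 0 ∨ ε j = 1 := by
      intro j
      by_cases hj : ∃ n, φ n = j
      · obtain ⟨n, rfl⟩ := hj
        exact Or.inr (Or.inr (hφe n))
      · exact Or.inr (Or.inl (Function.extend_apply' _ _ _ hj))
    have hconv : SeriesConverges (fun i => (ε i * (1 / 2) ^ r i) • V (μ i)) := by
      have : (fun i => (ε i * (1 / 2) ^ r i) • V (μ i)) =
          Function.extend φ (fun n => ((1 : ℝ) / 2) ^ r (φ n) • V (μ (φ n))) 0 := by
        ext j
        by_cases hj : ∃ n, φ n = j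
        · obtain ⟨n, rfl⟩ := hj
          rw [hφe, hφ.injective.extend_apply, one_mul]
        · simp [ε, Function.extend_apply' _ _ _ hj]
      rw [this, seriesConverges_extend hφ]
      refine SeriesConverges.of_summable (Summable.of_norm_bounded summable_half_pow fun n => ?_)
      rw [norm_smul, Real.norm_of_nonneg (by positivity)]
      exact (mul_le_of_le_one_right (by positivity) (hV _)).trans (hφ' n).2
    obtain ⟨J, hJ⟩ := ((hG ε hε).1 hconv).exists_norm_sum_Ico_le hδ
    obtain ⟨n, hn1, hn2, hn3⟩ := (hφ' J).1
    have h1 := hJ (2 ^ μ (φ J)) ((hφ.id_le J).trans ((hμ.id_le _).trans Nat.lt_two_pow_self.le))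
      n hn1
    rw [sum_blockSign_smul hμ u hn2.le, hφe, one_smul] at h1
    linarith
  rw [hG ε hε]
  have h2 : SeriesConverges (fun j => blockSign μ r ε j • u j) ↔
      SeriesConverges (fun i => ε i • residueSum u (μ i) (r i) 0) :=
    ⟨fun h => h.of_blockSign hμ, fun h => seriesConverges_blockSign_of hμ hε h hosc⟩
  rw [h2]
  refine (seriesConverges_iff_of_norm_sub_le summable_half_pow fun i => ?_).symm
  rw [mul_smul, ← smul_sub, norm_smul]
  refine le_trans ?_ (happrox i (r i) (hr i))
  refine mul_le_of_le_one_left (norm_nonneg _) ?_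
  rcases hε i with h | h | h <;> simp [h]

end

/-! ### Operations on dyadically equivalent sequences -/

section

variable {G H : Type*} [NormedAddCommGroup G] [NormedSpace ℝ G] [NormedAddCommGroup H]
  [NormedSpace ℝ H]

theorem abs_sign_mul_le {ε : ℝ} (hε : ε = -1 ∨ ε = 0 ∨ ε = 1) {t : ℝ} (ht : 0 ≤ t) :
    |ε * t| ≤ t := by
  rcases hε with h | h | h <;> simp [h, abs_of_nonneg ht, ht]

theorem tendsto_half_pow_comp {r : ℕ → ℕ} (hr : Tendsto r atTop atTop) :
    Tendsto (fun i => ((1 : ℝ) / 2) ^ r i) atTop (𝓝 0) :=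
  (tendsto_pow_atTop_nhds_zero_of_lt_one (by norm_num) (by norm_num)).comp hr

theorem extend_sign_smul {φ : ℕ → ℕ} (hφ : StrictMono φ) (r : ℕ → ℕ) (ε : ℕ → ℝ) (a : ℕ → G) :
    (fun i => (Function.extend φ ε 0 i * (1 / 2) ^ Function.extend φ r id i) • a i) =
      Function.extend φ (fun k => (ε k * (1 / 2) ^ r k) • a (φ k)) 0 := by
  ext i
  by_cases hi : ∃ k, φ k = i
  · obtain ⟨k, rfl⟩ := hi
    simp only [hφ.injective.extend_apply]
  · simp [Function.extend_apply' _ _ _ hi]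

/-- Off the range of `φ` the sign is `0`, and the exponent is set to `i` only to keep the
constraints on exponents; `k ≤ φ k` handles the range. -/
theorem DyadicEquiv.comp {V : ℕ → G} {v : ℕ → H} (h : DyadicEquiv V v) {φ : ℕ → ℕ}
    (hφ : StrictMono φ) : DyadicEquiv (fun k => V (φ k)) (fun k => v (φ k)) := by
  intro r ε hr hrt hε
  let r' : ℕ → ℕ := Function.extend φ r id
  let ε' : ℕ → ℝ := Function.extend φ ε 0
  have hr' : ∀ k, r' (φ k) = r k := fun k => hφ.injective.extend_apply _ _ k
  have hε' : ∀ k, ε' (φ k) = ε k := fun k => hφ.injective.extend_apply _ _ k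
  rw [← seriesConverges_extend hφ (fun k => (ε k * (1 / 2) ^ r k) • V (φ k)),
    ← seriesConverges_extend hφ (fun k => (ε k * (1 / 2) ^ r k) • v (φ k)),
    ← extend_sign_smul hφ r ε V, ← extend_sign_smul hφ r ε v]
  refine h r' ε' (fun i => ?_) (tendsto_atTop.2 fun B => ?_) (fun i => ?_)
  · by_cases hi : ∃ k, φ k = i
    · obtain ⟨k, rfl⟩ := hi
      rw [hr']
      exact (hr k).trans (hφ.id_le k)
    · simp [r', Function.extend_apply' _ _ _ hi]
  · obtain ⟨k₀, hk₀⟩ := (tendsto_atTop.1 hrt B).exists_forall_of_atTop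
    filter_upwards [eventually_ge_atTop (max B (φ k₀))] with i hi
    by_cases hi' : ∃ k, φ k = i
    · obtain ⟨k, rfl⟩ := hi'
      rw [hr']
      exact hk₀ k (hφ.le_iff_le.1 ((le_max_right _ _).trans hi))
    · simpa [r', Function.extend_apply' _ _ _ hi'] using (le_max_left _ _).trans hi
  · by_cases hi : ∃ k, φ k = i
    · obtain ⟨k, rfl⟩ := hi
      rw [hε']
      exact hε k
    · simp [ε', Function.extend_apply' _ _ _ hi]

/-- If `‖v (φ n)‖ ≥ 2 ^ n` along a subsequence, the coefficients `2⁻ⁿ` give a summable series for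
`V` but terms of norm at least `1` for `v`. -/
theorem DyadicEquiv.exists_norm_le [CompleteSpace G] {V : ℕ → G} {v : ℕ → H} (h : DyadicEquiv V v)
    {c : ℝ} (hV : ∀ i, ‖V i‖ ≤ c) : ∃ B, ∀ i, ‖v i‖ ≤ B := by
  by_contra! hcon
  have hfreq : ∀ n : ℕ, ∃ᶠ i in atTop, (2 : ℝ) ^ n ≤ ‖v i‖ := by
    intro n
    rw [frequently_atTop]
    by_contra! hN
    obtain ⟨N, hN⟩ := hN
    obtain ⟨i, hi⟩ := hcon (2 ^ n + ∑ i ∈ range N, ‖v i‖)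
    have hnn : 0 ≤ ∑ i ∈ range N, ‖v i‖ := Finset.sum_nonneg fun _ _ => norm_nonneg _
    rcases lt_or_ge i N with h1 | h1
    · have : ‖v i‖ ≤ ∑ i ∈ range N, ‖v i‖ := Finset.single_le_sum (f := fun i => ‖v i‖)
        (fun _ _ => norm_nonneg _) (Finset.mem_range.2 h1)
      have h2 : (0 : ℝ) < 2 ^ n := by positivity
      linarith
    · linarith [hN i h1]
  obtain ⟨φ, hφ, hφ'⟩ := extraction_forall_of_frequently hfreq
  have h1 := (h.comp hφ) id (fun _ => 1) (fun _ => le_rfl) tendsto_id (fun _ => by simp)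
  have h2 : SeriesConverges (fun i => ((1 : ℝ) * (1 / 2) ^ id i) • V (φ i)) := by
    refine SeriesConverges.of_summable
      (Summable.of_norm_bounded (summable_half_pow.mul_right c) fun n => ?_)
    rw [norm_smul, one_mul, Real.norm_of_nonneg (by positivity)]
    exact mul_le_mul_of_nonneg_left (hV _) (by positivity)
  obtain ⟨J, hJ⟩ := Metric.tendsto_atTop.1 (h1.1 h2).tendsto_zero 1 one_pos
  have h3 := hJ J le_rfl
  rw [dist_zero_right, norm_smul, one_mul, Real.norm_of_nonneg (by positivity)] at h3
  have h4 : (1 / 2 : ℝ) ^ id J * 2 ^ J ≤ (1 / 2) ^ id J * ‖v (φ J)‖ :=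
    mul_le_mul_of_nonneg_left (hφ' J) (by positivity)
  rw [id, ← mul_pow] at h4
  norm_num at h4 h3
  linarith

theorem seriesConverges_alternating_iff {v : ℕ → H} {B : ℝ} (hB : ∀ i, ‖v i‖ ≤ B) {t : ℕ → ℝ}
    (ht : Tendsto t atTop (𝓝 0)) :
    SeriesConverges (fun i => ((if Even i then 1 else -1) * t (i / 2)) • v i) ↔
      SeriesConverges (fun k => t k • (v (2 * k) - v (2 * k + 1))) := by
  have hK : StrictMono (fun k : ℕ => 2 * k) := fun a b h => by simpa using h
  have hblock : (fun k => ∑ i ∈ Finset.Ico (2 * k) (2 * (k + 1)),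
      ((if Even i then 1 else -1) * t (i / 2)) • v i) =
      fun k => t k • (v (2 * k) - v (2 * k + 1)) := by
    ext k
    have h1 : (2 * k + 1) / 2 = k := by omega
    rw [mul_add, mul_one, Finset.sum_Ico_succ_top (by omega), Finset.sum_Ico_succ_top (by omega)]
    simp [h1, sub_eq_add_neg]
  constructor
  · intro h
    have := h.block hK
    rwa [hblock] at this
  · intro h
    refine SeriesConverges.of_block hK (hblock ▸ h) fun δ hδ => ?_
    have h0 : Tendsto (fun k => |t k| * B) atTop (𝓝 0) := by simpa using ht.abs.mul_const B
    obtain ⟨J, hJ⟩ := (h0.eventually (gt_mem_nhds hδ)).exists_forall_of_atTop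
    refine ⟨J, fun k hk n h1 h2 => ?_⟩
    obtain rfl | rfl : n = 2 * k ∨ n = 2 * k + 1 := by omega
    · simpa using hδ.le
    · rw [Finset.sum_Ico_succ_top (by omega)]
      simp only [Finset.Ico_self, Finset.sum_empty, zero_add, norm_smul]
      refine le_trans ?_ (hJ k hk).le
      rw [if_pos (even_two_mul k), one_mul, Nat.mul_div_cancel_left k two_pos]
      exact mul_le_mul_of_nonneg_left (hB _) (abs_nonneg _)

/-- Repeating each coefficient twice with opposite signs produces the differences. It serves to turn
coordinatewise convergence into convergence to zero. -/
theorem DyadicEquiv.sub_pairs {V : ℕ → G} {v : ℕ → H} (h : DyadicEquiv V v) {B B' : ℝ}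
    (hV : ∀ i, ‖V i‖ ≤ B) (hv : ∀ i, ‖v i‖ ≤ B') :
    DyadicEquiv (fun k => V (2 * k) - V (2 * k + 1)) (fun k => v (2 * k) - v (2 * k + 1)) := by
  intro r ε hr hrt hε
  have ht : Tendsto (fun k => ε k * (1 / 2) ^ r k) atTop (𝓝 0) :=
    squeeze_zero_norm (fun k => abs_sign_mul_le (hε k) (by positivity)) (tendsto_half_pow_comp hrt)
  rw [← seriesConverges_alternating_iff hV ht, ← seriesConverges_alternating_iff hv ht]
  have := h (fun i => r (i / 2)) (fun i => (if Even i then 1 else -1) * ε (i / 2))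
    (fun i => (hr _).trans (Nat.div_le_self _ _))
    (hrt.comp (Nat.tendsto_div_const_atTop two_ne_zero)) (fun i => ?_)
  · simpa only [mul_assoc] using this
  · rcases hε (i / 2) with h | h | h <;> split_ifs <;> simp [h]

end

/-! ### Sequences in `l_p` -/

/-- The truncation of `f` to the coordinates below `n`. -/
noncomputable def truncate {p : ℝ≥0∞} (f : SeqLp p) (n : ℕ) : SeqLp p :=
  ∑ i ∈ range n, lp.single p i (f i)

theorem truncate_apply {p : ℝ≥0∞} (f : SeqLp p) (n i : ℕ) :
    truncate f n i = if i < n then f i else 0 := by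
  rw [truncate, lp.coeFn_sum, Finset.sum_apply]
  simp only [lp.single_apply, Pi.single_apply]
  rw [Finset.sum_ite_eq]
  simp

section Lp

variable {p : ℝ≥0∞} [hp1 : Fact (1 ≤ p)]

theorem toReal_pos_of_one_le (hp : p ≠ ∞) : 0 < p.toReal :=
  ENNReal.toReal_pos (lt_of_lt_of_le zero_lt_one hp1.out).ne' hp

theorem one_le_toReal (hp : p ≠ ∞) : 1 ≤ p.toReal := by
  simpa using ENNReal.toReal_mono hp hp1.out

/-- Second countability of the target is what the continuity of Borel maps on a dense `Gδ` set
requires. -/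
theorem secondCountableTopology_seqLp (hp : p ≠ ∞) : SecondCountableTopology (SeqLp p) := by
  have hsep : TopologicalSpace.IsSeparable (Set.univ : Set (SeqLp p)) := by
    let s : Set (SeqLp p) := Set.range fun i : ℕ =>
      lp.single (E := fun _ : ℕ => ℝ) p i 1
    have hs : TopologicalSpace.IsSeparable (closure (Submodule.span ℝ s : Set (SeqLp p))) :=
      ((Set.countable_range _).isSeparable.span (R := ℝ)).closure
    refine hs.mono fun f _ => ?_
    have hsum := (lp.hasSum_single hp f).tendsto_sum_nat
    refine mem_closure_of_tendsto hsum (Eventually.of_forall fun n => ?_)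
    refine Submodule.sum_mem _ fun i _ => ?_
    have : lp.single p i (f i) = (f i) • lp.single (E := fun _ : ℕ => ℝ) p i 1 := by
      rw [← lp.single_smul, smul_eq_mul, mul_one]
    rw [this]
    exact Submodule.smul_mem _ _ (Submodule.subset_span ⟨i, rfl⟩)
  have := TopologicalSpace.isSeparable_univ_iff.1 hsep
  exact UniformSpace.secondCountable_of_separable _

theorem continuous_seqLp_apply (i : ℕ) : Continuous fun f : SeqLp p => f i :=
  (lp.evalCLM ℝ (fun _ : ℕ => ℝ) p i).continuous

theorem norm_sum_rpow_of_disjoint (hp : p ≠ ∞) {z : ℕ → SeqLp p}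
    (hz : ∀ i k l, k ≠ l → z k i = 0 ∨ z l i = 0) (s : Finset ℕ) :
    ‖∑ k ∈ s, z k‖ ^ p.toReal = ∑ k ∈ s, ‖z k‖ ^ p.toReal := by
  have hpos := toReal_pos_of_one_le hp
  have hpt : ∀ i, ‖(∑ k ∈ s, z k : SeqLp p) i‖ ^ p.toReal = ∑ k ∈ s, ‖z k i‖ ^ p.toReal := by
    intro i
    rw [lp.coeFn_sum, Finset.sum_apply]
    by_cases h : ∃ k ∈ s, z k i ≠ 0
    · obtain ⟨k, hk, hki⟩ := h
      have h0 : ∀ l, l ≠ k → z l i = 0 := fun l hl => (hz i l k hl).resolve_right hki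
      rw [Finset.sum_eq_single_of_mem k hk fun l _ hl => h0 l hl,
        Finset.sum_eq_single_of_mem k hk fun l _ hl => by
          rw [h0 l hl, norm_zero, Real.zero_rpow hpos.ne']]
    · push Not at h
      rw [Finset.sum_eq_zero h, Finset.sum_eq_zero fun k hk => by
        rw [h k hk, norm_zero, Real.zero_rpow hpos.ne'], norm_zero, Real.zero_rpow hpos.ne']
  rw [lp.norm_rpow_eq_tsum hpos]
  simp only [hpt, lp.norm_rpow_eq_tsum hpos]
  exact Summable.tsum_finsetSum fun k _ => (lp.memℓp (z k)).summable hpos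

/-- A series of disjointly supported elements of `l_p` converges iff the norms are
`p`-summable. -/
theorem seriesConverges_iff_summable_of_disjoint (hp : p ≠ ∞) {z : ℕ → SeqLp p}
    (hz : ∀ i k l, k ≠ l → z k i = 0 ∨ z l i = 0) :
    SeriesConverges z ↔ Summable fun k => ‖z k‖ ^ p.toReal := by
  have hpos := toReal_pos_of_one_le hp
  have hnn : ∀ k, 0 ≤ ‖z k‖ ^ p.toReal := fun k => by positivity
  rw [← seriesConverges_nonneg_iff hnn]
  constructor
  · rintro ⟨l, hl⟩
    refine ⟨‖l‖ ^ p.toReal, ?_⟩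
    simp only [← norm_sum_rpow_of_disjoint hp hz]
    exact hl.norm.rpow_const (Or.inr hpos.le)
  · intro h
    refine cauchySeq_tendsto_of_complete (Metric.cauchySeq_iff'.2 fun δ hδ => ?_)
    obtain ⟨J, hJ⟩ := h.exists_norm_sum_Ico_le (half_pos (Real.rpow_pos_of_pos hδ p.toReal))
    refine ⟨J, fun n hn => ?_⟩
    rw [dist_eq_norm, ← Finset.sum_Ico_eq_sub _ hn]
    refine lt_of_not_ge fun hle => ?_
    have h1 := hJ J le_rfl n hn
    rw [← norm_sum_rpow_of_disjoint hp hz, Real.norm_of_nonneg (by positivity)] at h1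
    have h2 := Real.rpow_le_rpow hδ.le hle hpos.le
    have h3 := Real.rpow_pos_of_pos hδ p.toReal
    linarith

theorem tendsto_truncate (hp : p ≠ ∞) (f : SeqLp p) :
    Tendsto (truncate f) atTop (𝓝 f) :=
  (lp.hasSum_single hp f).tendsto_sum_nat

theorem tendsto_truncate_zero {w : ℕ → SeqLp p}
    (hw : ∀ i, Tendsto (fun k => w k i) atTop (𝓝 0)) (n : ℕ) :
    Tendsto (fun k => truncate (w k) n) atTop (𝓝 0) := by
  have h0 : (0 : SeqLp p) = ∑ i ∈ range n, lp.single p i (0 : ℝ) := by simp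
  rw [h0]
  refine tendsto_finsetSum _ fun i _ => ?_
  rw [lp.single_zero, tendsto_zero_iff_norm_tendsto_zero]
  simp only [lp.norm_single (lt_of_lt_of_le zero_lt_one hp1.out)]
  simpa using (hw i).norm

/-- Gliding hump: a coordinatewise null sequence in `l_p` has a subsequence that is close to a
disjointly supported sequence. -/
theorem exists_disjoint_approx (hp : p ≠ ∞) {w : ℕ → SeqLp p}
    (hw : ∀ i, Tendsto (fun k => w k i) atTop (𝓝 0)) :
    ∃ (φ : ℕ → ℕ) (z : ℕ → SeqLp p), StrictMono φ ∧
      (∀ i k l, k ≠ l → z k i = 0 ∨ z l i = 0) ∧ ∀ k, ‖w (φ k) - z k‖ ≤ (1 / 2) ^ k := by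
  have step : ∀ j k b : ℕ, ∃ k' b', k < k' ∧ b < b' ∧ ‖truncate (w k') b‖ ≤ (1 / 2) ^ j / 2 ∧
      ‖w k' - truncate (w k') b'‖ ≤ (1 / 2) ^ j / 2 := by
    intro j k b
    have hδ : (0 : ℝ) < (1 / 2) ^ j / 2 := by positivity
    obtain ⟨k', hk, hk'⟩ := ((eventually_gt_atTop k).and
      (((tendsto_truncate_zero hw b).norm).eventually
        (gt_mem_nhds (by rw [norm_zero]; exact hδ)))).exists
    obtain ⟨b', hb, hb'⟩ := ((eventually_gt_atTop b).and
      ((((tendsto_truncate hp (w k')).const_sub (w k')).norm).eventually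
        (gt_mem_nhds (by rw [sub_self, norm_zero]; exact hδ)))).exists
    exact ⟨k', b', hk, hb, hk'.le, hb'.le⟩
  choose k' b' hk hb h1 h2 using step
  -- The state is the last index and the last cut. Hump `j` occupies `[b j, b (j + 1))`; its
  -- discarded head and tail each cost half of `2⁻ʲ`.
  let st : ℕ → ℕ × ℕ := fun j => Nat.rec (0, 0) (fun j s => (k' j s.1 s.2, b' j s.1 s.2)) j
  let b := fun j => (st j).2
  let φ := fun j => (st (j + 1)).1
  have hφ : StrictMono φ := strictMono_nat_of_lt_succ fun j => hk _ _ _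
  have hbm : StrictMono b := strictMono_nat_of_lt_succ fun j => hb _ _ _
  have hb1 : ∀ j, ‖truncate (w (φ j)) (b j)‖ ≤ (1 / 2) ^ j / 2 := fun j => h1 _ _ _
  have hb2 : ∀ j, ‖w (φ j) - truncate (w (φ j)) (b (j + 1))‖ ≤ (1 / 2) ^ j / 2 := fun j => h2 _ _ _
  refine ⟨φ, fun j => truncate (w (φ j)) (b (j + 1)) - truncate (w (φ j)) (b j), hφ, ?_, ?_⟩
  · have hsupp : ∀ i k, (truncate (w (φ k)) (b (k + 1)) - truncate (w (φ k)) (b k)) i ≠ 0 →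
        b k ≤ i ∧ i < b (k + 1) := by
      intro i k h
      have := hbm (Nat.lt_succ_self k)
      rw [lp.coeFn_sub, Pi.sub_apply, truncate_apply, truncate_apply] at h
      by_contra hcon
      apply h
      split_ifs with h3 h4 h4
      · simp
      · exact absurd ⟨not_lt.1 h4, h3⟩ hcon
      · exact absurd (h4.trans this) h3
      · simp
    have hlt : ∀ i k l, k < l →
        (truncate (w (φ k)) (b (k + 1)) - truncate (w (φ k)) (b k)) i = 0 ∨
        (truncate (w (φ l)) (b (l + 1)) - truncate (w (φ l)) (b l)) i = 0 := by
      intro i k l hkl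
      by_contra! hcon
      have h3 := (hsupp i k hcon.1).2
      have h4 := (hsupp i l hcon.2).1
      have h5 := hbm.monotone (Nat.succ_le_of_lt hkl)
      simp only [Nat.succ_eq_add_one] at h5
      omega
    intro i k l hkl
    rcases lt_or_gt_of_ne hkl with h | h
    · exact hlt i k l h
    · exact (hlt i l k h).symm
  · intro j
    have : w (φ j) - (truncate (w (φ j)) (b (j + 1)) - truncate (w (φ j)) (b j)) =
        (w (φ j) - truncate (w (φ j)) (b (j + 1))) + truncate (w (φ j)) (b j) := by abel
    simp only [this]
    linarith [norm_add_le_of_le (hb2 j) (hb1 j)]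

/-- Passing to disjoint humps reduces convergence to summability of numbers, so the signs of the
coefficients no longer matter. -/
theorem exists_seriesConverges_iff_summable (hp : p ≠ ∞) {w : ℕ → SeqLp p}
    (hw : ∀ i, Tendsto (fun k => w k i) atTop (𝓝 0)) :
    ∃ (φ : ℕ → ℕ) (ρ : ℕ → ℝ), StrictMono φ ∧ (∀ k, 0 ≤ ρ k) ∧
      (∀ k, |ρ k - ‖w (φ k)‖| ≤ (1 / 2) ^ k) ∧ ∀ c : ℕ → ℝ, (∀ k, |c k| ≤ 1) →
      (SeriesConverges (fun k => c k • w (φ k)) ↔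
        Summable fun k => (|c k| * ρ k) ^ p.toReal) := by
  obtain ⟨φ, z, hφ, hz, hwz⟩ := exists_disjoint_approx hp hw
  refine ⟨φ, fun k => ‖z k‖, hφ, fun k => norm_nonneg _, fun k => ?_, fun c hc => ?_⟩
  · rw [abs_sub_comm]
    exact (abs_norm_sub_norm_le _ _).trans (hwz k)
  · have h1 : ∀ k, ‖c k • w (φ k) - c k • z k‖ ≤ (1 / 2) ^ k := fun k => by
      rw [← smul_sub, norm_smul]
      exact (mul_le_of_le_one_left (norm_nonneg _) (hc k)).trans (hwz k)
    rw [seriesConverges_iff_of_norm_sub_le summable_half_pow h1,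
      seriesConverges_iff_summable_of_disjoint hp]
    · simp only [norm_smul, Real.norm_eq_abs]
    · intro i k l hkl
      rcases hz i k l hkl with h | h
      · left; simp [h]
      · right; simp [h]

end Lp

/-! ### Dyadic sequences of prescribed decay -/

/-- Take `r k = ⌊log₂ (k + 1) / a⌋`, so that `2 ^ (-r k)` equals `(k + 1) ^ (-1 / a)` up to a factor
`2`. The assumption `1 ≤ a` gives `r k ≤ k`. -/
theorem exists_dyadic_exponents {a : ℝ} (ha : 1 ≤ a) :
    ∃ r : ℕ → ℕ, (∀ k, r k ≤ k) ∧ Monotone r ∧ Tendsto r atTop atTop ∧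
      (∀ k : ℕ, ((k : ℝ) + 1)⁻¹ ≤ (((1 : ℝ) / 2) ^ r k) ^ a) ∧
      ∀ k : ℕ, ((1 : ℝ) / 2) ^ r k ≤ 2 * ((k : ℝ) + 1) ^ (-a⁻¹) := by
  have ha0 : 0 < a := by linarith
  let L : ℕ → ℝ := fun k => Real.logb 2 (k + 1) / a
  have hk1 : ∀ k : ℕ, (1 : ℝ) ≤ k + 1 := fun k => by simp
  have hL0 : ∀ k, 0 ≤ L k := fun k => div_nonneg (Real.logb_nonneg (by norm_num) (hk1 k)) ha0.le
  have hpow : ∀ k, (2 : ℝ) ^ (-L k) = ((k : ℝ) + 1) ^ (-a⁻¹) := by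
    intro k
    have h1 : -L k = Real.logb 2 (k + 1) * (-a⁻¹) := by simp only [L]; ring
    rw [h1, Real.rpow_mul (by norm_num), Real.rpow_logb (by norm_num) (by norm_num) (by positivity)]
  have hhalf : ∀ n : ℕ, ((1 : ℝ) / 2) ^ n = 2 ^ (-(n : ℝ)) := by
    intro n
    rw [Real.rpow_neg (by norm_num), Real.rpow_natCast, one_div, inv_pow]
  refine ⟨fun k => ⌊L k⌋₊, fun k => ?_, fun k l hkl => ?_, ?_, fun k => ?_, fun k => ?_⟩
  · refine Nat.floor_le_of_le ((div_le_self (Real.logb_nonneg (by norm_num) (hk1 k)) ha).trans ?_)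
    rw [Real.logb_le_iff_le_rpow (by norm_num) (by positivity), Real.rpow_natCast]
    exact_mod_cast Nat.lt_two_pow_self
  · refine Nat.floor_le_floor (div_le_div_of_nonneg_right ?_ ha0.le)
    exact Real.logb_le_logb_of_le (by norm_num) (by positivity) (by gcongr)
  · refine tendsto_nat_floor_atTop.comp (Tendsto.atTop_div_const ha0 ?_)
    exact (Real.tendsto_logb_atTop (by norm_num)).comp
      (tendsto_atTop_add_const_right _ _ tendsto_natCast_atTop_atTop)
  · have h1 : (2 : ℝ) ^ (-L k) ≤ (1 / 2) ^ ⌊L k⌋₊ := by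
      rw [hhalf]
      exact Real.rpow_le_rpow_of_exponent_le (by norm_num) (neg_le_neg (Nat.floor_le (hL0 k)))
    calc ((k : ℝ) + 1)⁻¹ = (((k : ℝ) + 1) ^ (-a⁻¹)) ^ a := by
          rw [← Real.rpow_mul (by positivity), neg_mul, inv_mul_cancel₀ ha0.ne', Real.rpow_neg_one]
      _ ≤ _ := Real.rpow_le_rpow (by positivity) (hpow k ▸ h1) ha0.le
  · rw [← hpow, hhalf]
    calc (2 : ℝ) ^ (-(⌊L k⌋₊ : ℝ)) ≤ 2 ^ (1 + -L k) :=
          Real.rpow_le_rpow_of_exponent_le (by norm_num) (by linarith [Nat.lt_floor_add_one (L k)])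
      _ = _ := by rw [Real.rpow_add (by norm_num), Real.rpow_one]

theorem not_summable_of_inv_le {f : ℕ → ℝ} (hf : ∀ k : ℕ, ((k : ℝ) + 1)⁻¹ ≤ f k) :
    ¬ Summable f := by
  intro h
  have h1 : Summable fun k : ℕ => (((k + 1 : ℕ) : ℝ))⁻¹ :=
    Summable.of_nonneg_of_le (fun k => by positivity) (fun k => by simpa using hf k) h
  exact Real.not_summable_natCast_inv ((summable_nat_add_iff 1).1 h1)

theorem exists_dyadic_separating {a b : ℝ} (ha : 1 ≤ a) (hab : a < b) :
    ∃ r : ℕ → ℕ, (∀ k, r k ≤ k) ∧ Tendsto r atTop atTop ∧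
      (¬ Summable fun k => (((1 : ℝ) / 2) ^ r k) ^ a) ∧
      Summable fun k => (((1 : ℝ) / 2) ^ r k) ^ b := by
  obtain ⟨r, h1, -, h2, h3, h4⟩ := exists_dyadic_exponents ha
  have ha0 : 0 < a := by linarith
  refine ⟨r, h1, h2, not_summable_of_inv_le h3, ?_⟩
  have hs : Summable fun k : ℕ => (2 : ℝ) ^ b * (((k + 1 : ℕ) : ℝ)) ^ (-(b / a)) :=
    ((summable_nat_add_iff 1).2 (Real.summable_nat_rpow.2
      (by rw [neg_lt_neg_iff, one_lt_div ha0]; exact hab))).mul_left _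
  refine Summable.of_nonneg_of_le (fun k => by positivity) (fun k => ?_) hs
  calc (((1 : ℝ) / 2) ^ r k) ^ b ≤ (2 * ((k : ℝ) + 1) ^ (-a⁻¹)) ^ b :=
        Real.rpow_le_rpow (by positivity) (h4 k) (by linarith)
    _ = _ := by
      rw [Real.mul_rpow (by norm_num) (by positivity), ← Real.rpow_mul (by positivity)]
      push_cast
      congr 2
      field_simp

/-- Halving argument. The number `2⁻ⁱ t` is too small to be near a nonzero multiple of `τ`, so it is
within `δ` of `0`. Doubling gives at most `2 δ ≤ τ / 4`, again near a multiple, hence again at most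
`δ`; after `i` doublings `t` is reached. -/
theorem abs_le_of_near_multiples {t τ δ B : ℝ} {i : ℕ} (hδ : δ * 8 ≤ τ) (hδ0 : 0 < δ)
    (hB : (1 / 2) ^ i * B ≤ τ / 4) (ht : |t| ≤ B)
    (h : ∀ r ≤ i, ∃ s ∈ AddSubgroup.zmultiples τ, |(1 / 2) ^ r * t - s| ≤ δ) : |t| ≤ δ := by
  have small : ∀ x : ℝ, |x| ≤ τ / 4 → (∃ s ∈ AddSubgroup.zmultiples τ, |x - s| ≤ δ) →
      |x| ≤ δ := by
    rintro x hx ⟨s, ⟨k, rfl⟩, hs⟩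
    simp only [zsmul_eq_mul] at hs
    have hk : |(k : ℝ) * τ| < τ := by
      have := abs_sub_abs_le_abs_sub ((k : ℝ) * τ) x
      rw [abs_sub_comm] at this
      linarith
    have hτ : 0 < τ := by linarith
    rw [abs_mul, abs_of_pos hτ] at hk
    have hk1 : |(k : ℝ)| < 1 := by
      by_contra! hcon
      nlinarith
    have hk0 : k = 0 := by
      rw [← Int.abs_lt_one_iff]
      exact_mod_cast hk1
    simpa [hk0] using hs
  have key : ∀ d ≤ i, |(1 / 2) ^ (i - d) * t| ≤ δ := by
    intro d
    induction d with
    | zero =>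
      intro _
      refine small _ ?_ (h i le_rfl)
      rw [Nat.sub_zero, abs_mul, abs_of_pos (by positivity)]
      exact (mul_le_mul_of_nonneg_left ht (by positivity)).trans hB
    | succ d ih =>
      intro hd
      refine small _ ?_ (h _ (Nat.sub_le _ _))
      have h1 := ih (by omega)
      have h2 : i - d = (i - (d + 1)) + 1 := by omega
      rw [h2, pow_succ, mul_right_comm, abs_mul, abs_of_pos (by norm_num : (0 : ℝ) < 1 / 2)] at h1
      linarith
  simpa using key i le_rfl

/-- A Borel reduction of `E(G)` to `E(l_q)`, where `G` is embedded as a closed subgroup of `l_p`,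
makes a subsequence of `V` dyadically equivalent to a sequence in `l_q`, provided that `G`
contains `2⁻ᵐ V_m`. -/
theorem exists_dyadicEquiv_of_reduction {p q : ℝ≥0∞} [Fact (1 ≤ p)] [Fact (1 ≤ q)] (hq : q ≠ ∞)
    {G : Type*} [AddCommGroup G] [TopologicalSpace G] [IsTopologicalAddGroup G]
    (ι : G →+ SeqLp p)
    (hι : ∀ s : ℕ → G, (∃ l, Tendsto s atTop (𝓝 l)) ↔ ∃ l, Tendsto (fun n => ι (s n)) atTop (𝓝 l))
    {f : (ℕ → G) → ℕ → SeqLp q} (hf : @Measurable _ _ (borel (ℕ → G)) (borel (ℕ → SeqLp q)) f)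
    (hred : ∀ x y, (inducedEqRel G).r x y ↔ (inducedEqRel (SeqLp q)).r (f x) (f y))
    {V : ℕ → SeqLp p} (hV : ∀ m, ‖V m‖ ≤ 1) {β : ℕ → G}
    (hβ : ∀ m, ι (β m) = ((1 : ℝ) / 2) ^ m • V m) (S : AddSubgroup (SeqLp q))
    (hS : ∀ x k, f x k ∈ S) :
    ∃ (μ : ℕ → ℕ) (v : ℕ → SeqLp q), StrictMono μ ∧ DyadicEquiv (fun i => V (μ i)) v ∧
      ∀ i, ∀ r ≤ i, ∃ s ∈ S, ‖((1 : ℝ) / 2) ^ r • v i - s‖ ≤ (1 / 2) ^ i := by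
  have := secondCountableTopology_seqLp hq
  -- The category argument needs a countable discrete group, so the free abelian group on symbols
  -- mapped to `β m` stands in for `G`; partial sums turn sequences over it into sequences in `G`.
  let _ : TopologicalSpace (ℕ →₀ ℤ) := ⊥
  have : DiscreteTopology (ℕ →₀ ℤ) := ⟨rfl⟩
  let w : (ℕ →₀ ℤ) →+ G := Finsupp.liftAddHom fun m => zmultiplesHom G (β m)
  let Φ : (ℕ → ℕ →₀ ℤ) → ℕ → G := fun x n => ∑ i ∈ range n, w (x i)
  have hw : Continuous w := continuous_of_discreteTopology
  have hΦ : Continuous Φ := continuous_pi fun n =>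
    continuous_finsetSum _ fun i _ => hw.comp (continuous_apply i)
  have hwβ : ∀ m, ι (w (Finsupp.single m 1)) = ((1 : ℝ) / 2) ^ m • V m := by
    intro m
    rw [← hβ]
    simp [w]
  have hlog : Tendsto (Nat.log 2) atTop atTop :=
    tendsto_atTop.2 fun b => (eventually_ge_atTop (2 ^ b)).mono fun n hn =>
      Nat.le_log_of_pow_le (by norm_num) hn
  have hconv : ∀ x y, SeriesConverges (fun i => (ι.comp w) (x i - y i)) ↔
      ∃ l, Tendsto (fun k => f (Φ x) k - f (Φ y) k) atTop (𝓝 l) := by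
    intro x y
    rw [SeriesConverges]
    have h1 : ∀ n, ∑ i ∈ range n, (ι.comp w) (x i - y i) = ι (Φ x n - Φ y n) := by
      intro n
      simp [Φ, map_sum, Finset.sum_sub_distrib]
    simp only [h1]
    rw [← hι (fun n => Φ x n - Φ y n)]
    exact hred (Φ x) (Φ y)
  -- The index `Nat.log 2 j` repeats `2⁻ᵐ V m` exactly `2 ^ m` times.
  have hnull : Tendsto (fun j => (ι.comp w) (Finsupp.single (Nat.log 2 j) 1)) atTop (𝓝 0) := by
    simp only [AddMonoidHom.comp_apply, hwβ]
    refine squeeze_zero_norm (fun j => ?_) (tendsto_half_pow_comp hlog)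
    rw [norm_smul, Real.norm_of_nonneg (by positivity)]
    exact mul_le_of_le_one_right (by positivity) (hV _)
  obtain ⟨u, huS, hu⟩ := exists_seriesConverges_iff (ι.comp w) (hf.comp hΦ.borel_measurable) hconv
    _ hnull S fun x k => hS _ _
  simp only [AddMonoidHom.comp_apply, hwβ] at hu
  exact exists_dyadicEquiv hV hu S huS

/-! ### Obstructions to dyadic equivalence -/

section

variable {p q : ℝ≥0∞} [hp1 : Fact (1 ≤ p)] [hq1 : Fact (1 ≤ q)]

theorem abs_sign_mul_pow_le_one {r : ℕ} {ε : ℝ} (hε : ε = -1 ∨ ε = 0 ∨ ε = 1) :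
    |ε * (1 / 2) ^ r| ≤ 1 :=
  (abs_sign_mul_le hε (by positivity)).trans (pow_le_one₀ (by norm_num) (by norm_num))

/-- A constant sequence is not dyadically equivalent to a coordinatewise null sequence in `l_q`. -/
theorem not_dyadicEquiv_const (hq : q ≠ ∞) {G : Type*} [NormedAddCommGroup G] [NormedSpace ℝ G]
    (e : G) (ℓ : G →L[ℝ] ℝ) (hℓ : ℓ e = 1) {v : ℕ → SeqLp q}
    (hv : ∀ i, Tendsto (fun k => v k i) atTop (𝓝 0)) : ¬ DyadicEquiv (fun _ => e) v := by
  intro h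
  obtain ⟨φ, ρ, hφ, -, -, hρ⟩ := exists_seriesConverges_iff_summable hq hv
  -- With `a = 1` the weights decrease to `0` but dominate `1 / (k + 1)`: the alternating series
  -- along `e` converges and the positive one diverges, while on the side of `v` only absolute
  -- values count.
  obtain ⟨r, hr1, hrm, hrt, hr2, -⟩ := exists_dyadic_exponents le_rfl
  have hanti : Antitone fun k => ((1 : ℝ) / 2) ^ r k := fun k l hkl =>
    pow_le_pow_of_le_one (by norm_num) (by norm_num) (hrm hkl)
  have hsign : ∀ k : ℕ, (-1 : ℝ) ^ k = -1 ∨ (-1 : ℝ) ^ k = 0 ∨ (-1 : ℝ) ^ k = 1 := fun k =>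
    (neg_one_pow_eq_or ℝ k).elim (fun h => Or.inr (Or.inr h)) Or.inl
  have hone : ∀ k : ℕ, (1 : ℝ) = -1 ∨ (1 : ℝ) = 0 ∨ (1 : ℝ) = 1 := fun _ => by simp
  have h1 := h.comp hφ r (fun k => (-1) ^ k) hr1 hrt hsign
  have h2 := h.comp hφ r (fun _ => 1) hr1 hrt hone
  rw [hρ _ fun k => abs_sign_mul_pow_le_one (hsign k)] at h1
  rw [hρ _ fun k => abs_sign_mul_pow_le_one (hone k)] at h2
  simp only [abs_mul, abs_neg_one_pow, abs_one] at h1 h2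
  have h3 : SeriesConverges (fun k => ((-1 : ℝ) ^ k * (1 / 2) ^ r k) • e) := by
    obtain ⟨l, hl⟩ := hanti.tendsto_alternating_series_of_tendsto_zero (tendsto_half_pow_comp hrt)
    exact ⟨l • e, by simpa only [Finset.sum_smul] using hl.smul_const e⟩
  obtain ⟨l, hl⟩ := h2.2 (h1.1 h3)
  have h5 : SeriesConverges (fun k => ((1 : ℝ) / 2) ^ r k) := by
    refine ⟨ℓ l, ((ℓ.continuous.tendsto l).comp hl).congr fun n => ?_⟩
    simp only [Function.comp_apply, map_sum, map_smul, hℓ, smul_eq_mul, mul_one, one_mul]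
  rw [seriesConverges_nonneg_iff fun k => by positivity] at h5
  exact not_summable_of_inv_le (fun k => by simpa using hr2 k) h5

/-- Coordinate `c` of `A_p` lives in the discrete group `2⁻ᶜℤ`, so the halving argument applies with
`δ = 2⁻ⁱ` once `i` is large. -/
theorem tendsto_apply_zero_of_near_dyadic {v : ℕ → SeqLp p} {B : ℝ}
    (hB : ∀ i, ‖v i‖ ≤ B)
    (hv : ∀ i, ∀ r ≤ i, ∃ s ∈ subgroupDyadic p, ‖((1 : ℝ) / 2) ^ r • v i - s‖ ≤ (1 / 2) ^ i)
    (c : ℕ) : Tendsto (fun i => v i c) atTop (𝓝 0) := by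
  have hp0 : p ≠ 0 := (lt_of_lt_of_le zero_lt_one hp1.out).ne'
  have hpow : Tendsto (fun i : ℕ => ((1 : ℝ) / 2) ^ i) atTop (𝓝 0) :=
    tendsto_pow_atTop_nhds_zero_of_lt_one (by norm_num) (by norm_num)
  have hτ : (0 : ℝ) < ((2 : ℝ) ^ c)⁻¹ := by positivity
  refine squeeze_zero_norm' ?_ hpow
  have e1 : ∀ᶠ i : ℕ in atTop, ((1 : ℝ) / 2) ^ i * 8 ≤ ((2 : ℝ) ^ c)⁻¹ :=
    ((hpow.mul_const 8).eventually (gt_mem_nhds (by simp))).mono fun _ h => h.le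
  have e2 : ∀ᶠ i : ℕ in atTop, ((1 : ℝ) / 2) ^ i * B ≤ ((2 : ℝ) ^ c)⁻¹ / 4 :=
    ((hpow.mul_const B).eventually (gt_mem_nhds (by simp))).mono fun _ h => h.le
  filter_upwards [e1, e2] with i h1 h2
  refine abs_le_of_near_multiples h1 (by positivity) h2
    ((lp.norm_apply_le_norm hp0 (v i) c).trans (hB i)) fun r hr => ?_
  obtain ⟨s, hs, hs'⟩ := hv i r hr
  exact ⟨s c, hs c, (lp.norm_apply_le_norm hp0 _ c).trans hs'⟩

/-- Unit vectors of `l_p` and a sequence in `l_q` can be dyadically equivalent only if `p = q`. -/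
theorem eq_of_dyadicEquiv_single (hp : p ≠ ∞) (hq : q ≠ ∞) {μ : ℕ → ℕ} (hμ : StrictMono μ)
    {v : ℕ → SeqLp q}
    (h : DyadicEquiv (fun i => (lp.single p (μ i) (1 : ℝ) : SeqLp p)) v) : p = q := by
  have hp0 : 0 < p := lt_of_lt_of_le zero_lt_one hp1.out
  have hq0 : q ≠ 0 := (lt_of_lt_of_le zero_lt_one hq1.out).ne'
  have hpos := toReal_pos_of_one_le hp
  have hqos := toReal_pos_of_one_le hq
  have hV : ∀ i, ‖(lp.single p (μ i) (1 : ℝ) : SeqLp p)‖ ≤ 1 := fun i => by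
    rw [lp.norm_single hp0]; simp
  obtain ⟨B, hB⟩ := h.exists_norm_le hV
  -- pass to a coordinatewise convergent subsequence
  obtain ⟨a, -, ψ, hψ, ha⟩ :=
    (isCompact_univ_pi fun _ : ℕ => isCompact_Icc (a := -B) (b := B)).tendsto_subseq
      (x := fun k i => v k i) (fun k i _ => abs_le.1
      ((lp.norm_apply_le_norm hq0 (v k) i).trans (hB k)))
  -- The coordinatewise limit `a` need not vanish or lie in `l_q`; differences of consecutive terms
  -- remove it.
  have h1 := (h.comp hψ).sub_pairs (fun i => hV _) (fun i => hB _)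
  let W : ℕ → SeqLp p := fun k =>
    lp.single p (μ (ψ (2 * k))) (1 : ℝ) - lp.single p (μ (ψ (2 * k + 1))) (1 : ℝ)
  let w : ℕ → SeqLp q := fun k => v (ψ (2 * k)) - v (ψ (2 * k + 1))
  have h2 : DyadicEquiv W w := h1
  have hw : ∀ i, Tendsto (fun k => w k i) atTop (𝓝 0) := by
    intro i
    have hi := (tendsto_pi_nhds.1 ha) i
    have t1 : Tendsto (fun k : ℕ => 2 * k) atTop atTop := 
      StrictMono.tendsto_atTop fun a b h => by simpa using h
    have t2 : Tendsto (fun k : ℕ => 2 * k + 1) atTop atTop :=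
      StrictMono.tendsto_atTop fun a b h => by simpa using h
    simpa [w] using (hi.comp t1).sub (hi.comp t2)
  have hwB : ∀ k, ‖w k‖ ≤ B + B := fun k => norm_sub_le_of_le (hB _) (hB _)
  have hinj : Function.Injective fun i => μ (ψ i) := (hμ.comp hψ).injective
  have hWi : ∀ k i, W k i ≠ 0 → i = μ (ψ (2 * k)) ∨ i = μ (ψ (2 * k + 1)) := by
    intro k i hne
    by_contra! hcon
    apply hne
    simp only [W, lp.coeFn_sub, Pi.sub_apply, lp.single_apply_ne _ _ _ hcon.1,
      lp.single_apply_ne _ _ _ hcon.2, sub_self]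
  have hWd : ∀ i k l, k ≠ l → W k i = 0 ∨ W l i = 0 := by
    intro i k l hkl
    by_contra! hcon
    rcases hWi k i hcon.1 with hk | hk <;> rcases hWi l i hcon.2 with hl | hl <;>
      · have := hinj (hk.symm.trans hl)
        omega
  have hW1 : ∀ k, 1 ≤ ‖W k‖ := by
    intro k
    have hne : μ (ψ (2 * k)) ≠ μ (ψ (2 * k + 1)) := fun h => by
      have := hinj h
      omega
    have := lp.norm_apply_le_norm hp0.ne' (W k) (μ (ψ (2 * k)))
    rw [lp.coeFn_sub, Pi.sub_apply, lp.single_apply_self, lp.single_apply_ne _ _ _ hne] at this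
    simpa using this
  have hW2 : ∀ k, ‖W k‖ ≤ 2 := fun k => (norm_sub_le_of_le (hV _) (hV _)).trans (by norm_num)
  have hWsum : ∀ (φ : ℕ → ℕ), StrictMono φ → ∀ c : ℕ → ℝ,
      (SeriesConverges (fun k => c k • W (φ k)) ↔ Summable fun k => |c k| ^ p.toReal) := by
    intro φ hφ c
    rw [seriesConverges_iff_summable_of_disjoint hp]
    · constructor
      · refine fun h => Summable.of_nonneg_of_le (fun k => by positivity) (fun k => ?_) h
        refine Real.rpow_le_rpow (abs_nonneg _) ?_ hpos.le
        rw [norm_smul, Real.norm_eq_abs]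
        exact le_mul_of_one_le_right (abs_nonneg _) (hW1 _)
      · refine fun h => Summable.of_nonneg_of_le (fun k => by positivity) (fun k => ?_)
          (h.mul_right (2 ^ p.toReal))
        rw [← Real.mul_rpow (abs_nonneg _) (by norm_num)]
        refine Real.rpow_le_rpow (norm_nonneg _) ?_ hpos.le
        rw [norm_smul, Real.norm_eq_abs]
        exact mul_le_mul_of_nonneg_left (hW2 _) (abs_nonneg _)
    · intro i k l hkl
      rcases hWd i (φ k) (φ l) (hφ.injective.ne hkl) with h | h
      · left; simp [h]
      · right; simp [h]
  have hone : ∀ k : ℕ, (1 : ℝ) = -1 ∨ (1 : ℝ) = 0 ∨ (1 : ℝ) = 1 := fun _ => by simp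
  -- the norms of `w` are bounded below
  have hlow : ∃ n : ℕ, ∀ᶠ k in atTop, ((1 : ℝ) / 2) ^ n ≤ ‖w k‖ := by
    -- Otherwise some subsequence of `w` has summable norms and all its admissible series converge,
    -- although a dyadic sequence that is not `p`-summable diverges along `W`.
    by_contra hcon
    push Not at hcon
    obtain ⟨φ, hφ, hφ'⟩ := extraction_forall_of_frequently hcon
    obtain ⟨r, hr1, -, hrt, hr2, -⟩ := exists_dyadic_exponents (one_le_toReal hp)
    have h3 := h2.comp hφ r (fun _ => 1) hr1 hrt hone
    rw [hWsum φ hφ] at h3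
    refine not_summable_of_inv_le (fun k => ?_) (h3.2 (SeriesConverges.of_summable
      (Summable.of_norm_bounded summable_half_pow fun k => ?_)))
    · rw [one_mul, abs_of_pos (by positivity)]
      exact hr2 k
    · rw [norm_smul]
      exact (mul_le_of_le_one_left (norm_nonneg _) (abs_sign_mul_pow_le_one (hone k))).trans
        (hφ' k).le
  obtain ⟨n, hn⟩ := hlow
  obtain ⟨φ, ρ, hφ, hρ0, hρ, hρs⟩ := exists_seriesConverges_iff_summable hq hw
  -- Half of the lower bound for `‖w k‖`; the other half absorbs the error `2⁻ᵏ` in `ρ k`.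
  set c : ℝ := (1 / 2) ^ (n + 1) with hc
  have hc0 : 0 < c := by positivity
  have hρlow : ∀ᶠ k in atTop, c ≤ ρ k := by
    filter_upwards [hφ.tendsto_atTop.eventually hn, eventually_ge_atTop (n + 1)] with k hk hk'
    have h3 := (abs_le.1 (hρ k)).1
    have h4 : ((1 : ℝ) / 2) ^ k ≤ c := pow_le_pow_of_le_one (by norm_num) (by norm_num) hk'
    have h5 : ((1 : ℝ) / 2) ^ n = 2 * c := by rw [hc, pow_succ]; ring
    linarith
  have hρup : ∀ k, ρ k ≤ B + B + 1 := fun k => by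
    have h3 := (abs_le.1 (hρ k)).2
    have h4 : ((1 : ℝ) / 2) ^ k ≤ 1 := pow_le_one₀ (by norm_num) (by norm_num)
    linarith [hwB (φ k)]
  -- The weights `ρ` are bounded above and eventually bounded away from `0`, so they do not
  -- influence summability.
  have hfinal : ∀ r : ℕ → ℕ, (∀ k, r k ≤ k) → Tendsto r atTop atTop →
      ((Summable fun k => (((1 : ℝ) / 2) ^ r k) ^ p.toReal) ↔
        Summable fun k => (((1 : ℝ) / 2) ^ r k) ^ q.toReal) := by
    intro r hr hrt
    have h3 := h2.comp hφ r (fun _ => 1) hr hrt hone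
    rw [hWsum φ hφ, hρs _ fun k => abs_sign_mul_pow_le_one (hone k)] at h3
    have habs : ∀ k, |(1 : ℝ) * (1 / 2) ^ r k| = (1 / 2) ^ r k := fun k => by
      rw [one_mul, abs_of_pos (by positivity)]
    simp only [habs] at h3
    rw [h3]
    constructor
    · intro h4
      refine Summable.of_norm_bounded_eventually_nat (h4.mul_right ((c ^ q.toReal)⁻¹)) ?_
      filter_upwards [hρlow] with k hk
      have hcq : 0 < c ^ q.toReal := Real.rpow_pos_of_pos hc0 _
      rw [Real.norm_of_nonneg (by positivity), ← div_eq_mul_inv, le_div_iff₀ hcq,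
        ← Real.mul_rpow (by positivity) hc0.le]
      exact Real.rpow_le_rpow (by positivity) (mul_le_mul_of_nonneg_left hk (by positivity)) hqos.le
    · intro h4
      refine Summable.of_nonneg_of_le (fun k => ?_) (fun k => ?_)
        (h4.mul_right ((B + B + 1) ^ q.toReal))
      · exact Real.rpow_nonneg (mul_nonneg (by positivity) (hρ0 k)) _
      · rw [← Real.mul_rpow (by positivity) ((hρ0 k).trans (hρup k))]
        exact Real.rpow_le_rpow (mul_nonneg (by positivity) (hρ0 k))
          (mul_le_mul_of_nonneg_left (hρup k) (by positivity)) hqos.le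
  by_contra hne
  have hne' : p.toReal ≠ q.toReal := fun h => hne ((ENNReal.toReal_eq_toReal_iff' hp hq).1 h)
  rcases lt_or_gt_of_ne hne' with hlt | hlt
  · obtain ⟨r, hr, hrt, h3, h4⟩ := exists_dyadic_separating (one_le_toReal hp) hlt
    exact h3 ((hfinal r hr hrt).2 h4)
  · obtain ⟨r, hr, hrt, h3, h4⟩ := exists_dyadic_separating (one_le_toReal hq) hlt
    exact h3 ((hfinal r hr hrt).1 h4)

end

/-! ### Reductions -/

theorem borelReducible_of_hom {G H : Type*} [AddGroup G] [TopologicalSpace G]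
    [IsTopologicalAddGroup G] [AddGroup H] [TopologicalSpace H] [IsTopologicalAddGroup H]
    (S : G →+ H) (hc : Continuous S)
    (hS : ∀ s : ℕ → G, (∃ l, Tendsto s atTop (𝓝 l)) ↔ ∃ l, Tendsto (fun n => S (s n)) atTop (𝓝 l)) :
    BorelReducible (inducedEqRel G) (inducedEqRel H) := by
  refine ⟨fun x n => S (x n), ?_, fun x y => ?_⟩
  · exact (continuous_pi fun n => hc.comp (continuous_apply n)).borel_measurable
  · refine (hS fun n => x n - y n).trans ?_
    simp only [map_sub]
    rfl

theorem BorelReducible.trans {X Y Z : Type*} [TopologicalSpace X] [TopologicalSpace Y]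
    [TopologicalSpace Z] {E : Setoid X} {F : Setoid Y} {R : Setoid Z} (h : BorelReducible E F)
    (h' : BorelReducible F R) : BorelReducible E R := by
  obtain ⟨f, hf, hf'⟩ := h
  obtain ⟨g, hg, hg'⟩ := h'
  exact ⟨g ∘ f, hg.comp hf, fun x y => (hf' x y).trans (hg' _ _)⟩

/-- In a discrete group, `x - y` converges iff the increments of `x` and `y` eventually agree. Bit
`(n, m)` records whether increment `n` has code `m`. -/
theorem inducedEqRel_borelReducible_eqRelE0 (G : Type*) [AddCommGroup G] [TopologicalSpace G]
    [IsTopologicalAddGroup G] [DiscreteTopology G] [Countable G] :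
    BorelReducible (inducedEqRel G) eqRelE0 := by
  classical
  obtain ⟨c, hc⟩ := Countable.exists_injective_nat G
  let f : (ℕ → G) → ℕ → Bool := fun x i =>
    decide (c (x (i.unpair.1 + 1) - x i.unpair.1) = i.unpair.2)
  refine ⟨f, Continuous.borel_measurable (continuous_pi fun i => ?_), fun x y => ?_⟩
  · exact (continuous_of_discreteTopology (f := fun g : G => decide (c g = i.unpair.2))).comp
      ((continuous_apply (i.unpair.1 + 1)).sub (continuous_apply i.unpair.1))
  change (∃ l, Tendsto (fun n => x n - y n) atTop (𝓝 l)) ↔ ∃ m : ℕ, ∀ n > m, f x n = f y n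
  simp only [nhds_discrete, tendsto_pure]
  constructor
  · rintro ⟨l, hl⟩
    obtain ⟨N, hN⟩ := hl.exists_forall_of_atTop
    -- For a given `n`, the bits of `x` and `y` can be true only at the two positions added here;
    -- beyond them both are false.
    let b : ℕ → ℕ := fun n => Nat.pair n (c (x (n + 1) - x n)) + Nat.pair n (c (y (n + 1) - y n))
    refine ⟨∑ n ∈ range N, b n, fun i hi => ?_⟩
    rcases lt_or_ge i.unpair.1 N with h | h
    · have hb : b i.unpair.1 < i :=
        lt_of_le_of_lt (Finset.single_le_sum (fun _ _ => Nat.zero_le _) (Finset.mem_range.2 h)) hi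
      have h1 : c (x (i.unpair.1 + 1) - x i.unpair.1) ≠ i.unpair.2 := by
        intro he
        simp only [b, he, Nat.pair_unpair] at hb
        omega
      have h2 : c (y (i.unpair.1 + 1) - y i.unpair.1) ≠ i.unpair.2 := by
        intro he
        simp only [b, he, Nat.pair_unpair] at hb
        omega
      simp only [f, h1, h2]
    · have h1 := hN _ h
      have h2 := hN _ (h.trans (Nat.le_succ _))
      have h3 : x (i.unpair.1 + 1) - x i.unpair.1 = y (i.unpair.1 + 1) - y i.unpair.1 := by
        rw [sub_eq_sub_iff_add_eq_add]
        rw [sub_eq_iff_eq_add] at h1 h2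
        rw [h1, h2, Nat.succ_eq_add_one]
        abel
      simp only [f, h3]
  · rintro ⟨m, hm⟩
    have h1 : ∀ n > m, x (n + 1) - x n = y (n + 1) - y n := by
      intro n hn
      have h2 := hm (Nat.pair n (c (x (n + 1) - x n))) (lt_of_lt_of_le hn (Nat.left_le_pair _ _))
      simp only [f, Nat.unpair_pair] at h2
      exact (hc (by simpa using h2.symm)).symm
    refine ⟨x (m + 1) - y (m + 1), eventually_atTop.2 ⟨m + 1, fun n hn => ?_⟩⟩
    induction n, hn using Nat.le_induction with
    | base => rfl
    | succ n hn ih =>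
      rw [← ih]
      have := h1 n hn
      rw [sub_eq_sub_iff_add_eq_add] at this ⊢
      rw [this, add_comm]

/-- Zeros at the even places force the eventually constant difference to be `0`. -/
theorem eqRelE0_borelReducible_inducedEqRel {G : Type*} [AddCommGroup G] [TopologicalSpace G]
    [IsTopologicalAddGroup G] [DiscreteTopology G] {g : G} (hg : g ≠ 0) :
    BorelReducible eqRelE0 (inducedEqRel G) := by
  let f : (ℕ → Bool) → ℕ → G := fun x n => if Even n then 0 else if x (n / 2) then g else 0
  refine ⟨f, Continuous.borel_measurable (continuous_pi fun n => ?_), fun x y => ?_⟩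
  · exact (continuous_of_discreteTopology
      (f := fun t : Bool => if Even n then (0 : G) else if t then g else 0)).comp
      (continuous_apply (n / 2))
  change (∃ m : ℕ, ∀ n > m, x n = y n) ↔ ∃ l, Tendsto (fun n => f x n - f y n) atTop (𝓝 l)
  simp only [nhds_discrete, tendsto_pure]
  constructor
  · rintro ⟨m, hm⟩
    refine ⟨0, eventually_atTop.2 ⟨2 * m + 2, fun n hn => ?_⟩⟩
    simp only [f, hm (n / 2) (by omega), sub_self]
  · rintro ⟨l, hl⟩
    obtain ⟨N, hN⟩ := hl.exists_forall_of_atTop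
    refine ⟨N, fun n hn => ?_⟩
    have h1 := hN (2 * n) (by omega)
    have h2 := hN (2 * n + 1) (by omega)
    have h3 : (2 * n + 1) / 2 = n := by omega
    simp only [f, even_two_mul, if_true, sub_self] at h1
    simp only [f, Nat.not_even_two_mul_add_one, if_false, h3, ← h1] at h2
    cases hx : x n <;> cases hy : y n <;> simp [hx, hy, hg] at h2 ⊢

/-! ### The subgroups `A_{p,a}`: discreteness, closedness and embeddings -/

theorem eq_zero_of_mem_zmultiples_of_abs_lt {a x : ℝ} (hx : x ∈ AddSubgroup.zmultiples a)
    (h : |x| < |a|) : x = 0 := by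
  obtain ⟨k, rfl⟩ := hx
  simp only [zsmul_eq_mul, abs_mul] at h ⊢
  have hk1 : |(k : ℝ)| < 1 := by
    by_contra! hcon
    nlinarith [abs_nonneg a]
  have hk0 : k = 0 := by
    rw [← Int.abs_lt_one_iff]
    exact_mod_cast hk1
  simp [hk0]

theorem subgroupA_eq_zero {p : ℝ≥0∞} {a : ℕ → ℝ} (v : subgroupA p a) {n : ℕ} (hn : a n = 0) :
    (v : SeqLp p) n = 0 := by
  obtain ⟨k, hk⟩ := v.2 n
  rw [← hk, hn]
  simp

theorem countable_subgroupA {p : ℝ≥0∞} {a : ℕ → ℝ} (ha : {n | a n ≠ 0}.Finite) :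
    Countable (subgroupA p a) := by
  have := ha.to_subtype
  let F : subgroupA p a → (n : {n | a n ≠ 0}) → AddSubgroup.zmultiples (a n) :=
    fun v n => ⟨(v : SeqLp p) n, v.2 n⟩
  refine Function.Injective.countable (f := F) fun v w h => ?_
  ext n
  by_cases hn : a n = 0
  · rw [subgroupA_eq_zero v hn, subgroupA_eq_zero w hn]
  · exact congrArg Subtype.val (congrFun h ⟨n, hn⟩)

section

variable {p : ℝ≥0∞} [hp1 : Fact (1 ≤ p)]

theorem isClosed_subgroupA (a : ℕ → ℝ) : IsClosed (subgroupA p a : Set (SeqLp p)) := by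
  have : (subgroupA p a : Set (SeqLp p)) =
      ⋂ n, (fun f : SeqLp p => f n) ⁻¹' (AddSubgroup.zmultiples (a n) : Set ℝ) := by
    ext f
    simp only [Set.mem_iInter]
    rfl
  rw [this]
  exact isClosed_iInter fun n =>
    (AddSubgroup.isClosed_of_discrete).preimage (continuous_seqLp_apply n)

/-- The subgroup is closed, so a limit taken in `l_p` stays in it. -/
theorem tendsto_subgroupA_iff (a : ℕ → ℝ) (s : ℕ → subgroupA p a) :
    (∃ l, Tendsto s atTop (𝓝 l)) ↔
      ∃ l, Tendsto (fun n => (subgroupA p a).subtype (s n)) atTop (𝓝 l) := by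
  constructor
  · rintro ⟨l, hl⟩
    exact ⟨l, (continuous_subtype_val.tendsto l).comp hl⟩
  · rintro ⟨l, hl⟩
    have hmem : l ∈ subgroupA p a :=
      (isClosed_subgroupA a).mem_of_tendsto hl (Eventually.of_forall fun n => (s n).2)
    exact ⟨⟨l, hmem⟩, tendsto_subtype_rng.2 hl⟩

theorem subgroupA_borelReducible_seqLp (a : ℕ → ℝ) :
    BorelReducible (inducedEqRel (subgroupA p a)) (inducedEqRel (SeqLp p)) :=
  borelReducible_of_hom (subgroupA p a).subtype continuous_subtype_val (tendsto_subgroupA_iff a)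

/-- A multiple of `a n` smaller than `|a n|` vanishes, so finitely many open conditions isolate `0`.
-/
theorem discreteTopology_subgroupA {a : ℕ → ℝ} (ha : {n | a n ≠ 0}.Finite) :
    DiscreteTopology (subgroupA p a) := by
  refine discreteTopology_of_isOpen_singleton_zero ?_
  have : ({0} : Set (subgroupA p a)) =
      ⋂ n ∈ {n | a n ≠ 0}, {v : subgroupA p a | |(v : SeqLp p) n| < |a n|} := by
    ext v
    simp only [Set.mem_singleton_iff, Set.mem_iInter]
    constructor
    · rintro rfl n hn
      simpa using hn
    · intro h
      ext n
      by_cases hn : a n = 0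
      · exact subgroupA_eq_zero v hn
      · exact eq_zero_of_mem_zmultiples_of_abs_lt (v.2 n) (h n hn)
  rw [this]
  exact ha.isOpen_biInter fun n _ => isOpen_lt
    ((continuous_seqLp_apply n).comp continuous_subtype_val).abs continuous_const

theorem subgroupA_bireducible_eqRelE0 {a : ℕ → ℝ} (hne : {n | a n ≠ 0}.Nonempty)
    (ha : {n | a n ≠ 0}.Finite) : BorelBireducible (inducedEqRel (subgroupA p a)) eqRelE0 := by
  have := countable_subgroupA (p := p) ha
  have := discreteTopology_subgroupA (p := p) ha
  refine ⟨inducedEqRel_borelReducible_eqRelE0 _, ?_⟩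
  obtain ⟨n, hn⟩ := hne
  have hmem : (lp.single p n (a n) : SeqLp p) ∈ subgroupA p a := by
    intro i
    rcases eq_or_ne i n with rfl | h
    · rw [lp.single_apply_self]
      exact AddSubgroup.mem_zmultiples _
    · rw [lp.single_apply_ne _ _ _ h]
      exact zero_mem _
  refine eqRelE0_borelReducible_inducedEqRel (g := ⟨_, hmem⟩) fun h => hn ?_
  have h1 := congrArg (fun f : subgroupA p a => (f : SeqLp p) n) h
  simpa [lp.single_apply_self] using h1

/-- The coordinates of `f` multiplied by `c` and moved along the injection `k`. -/
noncomputable def scaleReindex (hp : p ≠ ∞) (c : ℕ → ℝ) (hc : ∀ n, |c n| ≤ 1) {k : ℕ → ℕ}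
    (hk : Function.Injective k) : SeqLp p →+ SeqLp p where
  toFun f := ⟨Function.extend k (fun n => c n * f n) 0, by
    have hpos := toReal_pos_of_one_le hp
    refine (memℓp_gen_iff hpos).2 ?_
    have h1 : (fun i => ‖Function.extend k (fun n => c n * f n) 0 i‖ ^ p.toReal) =
        Function.extend k (fun n => ‖c n * f n‖ ^ p.toReal) 0 := by
      ext i
      by_cases hi : ∃ n, k n = i
      · obtain ⟨n, rfl⟩ := hi
        simp only [hk.extend_apply]
      · simp [Function.extend_apply' _ _ _ hi, hpos.ne']
    rw [h1, summable_extend_zero hk]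
    refine Summable.of_nonneg_of_le (fun n => by positivity) (fun n => ?_)
      ((lp.memℓp f).summable hpos)
    rw [norm_mul]
    exact Real.rpow_le_rpow (by positivity) (mul_le_of_le_one_left (norm_nonneg _) (hc n)) hpos.le⟩
  map_zero' := by
    ext i
    change Function.extend k (fun n => c n * 0) 0 i = 0
    by_cases hi : ∃ n, k n = i
    · obtain ⟨n, rfl⟩ := hi
      rw [hk.extend_apply, mul_zero]
    · rw [Function.extend_apply' _ _ _ hi, Pi.zero_apply]
  map_add' f g := by
    ext i
    change Function.extend k (fun n => c n * (f n + g n)) 0 i =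
      Function.extend k (fun n => c n * f n) 0 i + Function.extend k (fun n => c n * g n) 0 i
    by_cases hi : ∃ n, k n = i
    · obtain ⟨n, rfl⟩ := hi
      simp only [hk.extend_apply, mul_add]
    · simp only [Function.extend_apply' _ _ _ hi, Pi.zero_apply, add_zero]

theorem norm_scaleReindex_rpow (hp : p ≠ ∞) {c : ℕ → ℝ} (hc : ∀ n, |c n| ≤ 1) {k : ℕ → ℕ}
    (hk : Function.Injective k) (f : SeqLp p) :
    ‖scaleReindex hp c hc hk f‖ ^ p.toReal = ∑' n, ‖c n * f n‖ ^ p.toReal := by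
  have hpos := toReal_pos_of_one_le hp
  rw [lp.norm_rpow_eq_tsum hpos, ← tsum_extend_zero hk fun n => ‖c n * f n‖ ^ p.toReal]
  congr 1
  ext i
  change ‖Function.extend k (fun n => c n * f n) 0 i‖ ^ p.toReal = _
  by_cases hi : ∃ n, k n = i
  · obtain ⟨n, rfl⟩ := hi
    simp only [hk.extend_apply]
  · simp [Function.extend_apply' _ _ _ hi, hpos.ne']

theorem norm_scaleReindex_le (hp : p ≠ ∞) {c : ℕ → ℝ} (hc : ∀ n, |c n| ≤ 1) {k : ℕ → ℕ}
    (hk : Function.Injective k) (f : SeqLp p) : ‖scaleReindex hp c hc hk f‖ ≤ ‖f‖ := by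
  have hpos := toReal_pos_of_one_le hp
  rw [← Real.rpow_le_rpow_iff (norm_nonneg _) (norm_nonneg _) hpos,
    norm_scaleReindex_rpow, lp.norm_rpow_eq_tsum hpos]
  have hf := (lp.memℓp f).summable hpos
  have hle : ∀ n, ‖c n * f n‖ ^ p.toReal ≤ ‖f n‖ ^ p.toReal := fun n => by
    rw [norm_mul]
    exact Real.rpow_le_rpow (by positivity) (mul_le_of_le_one_left (norm_nonneg _) (hc n)) hpos.le
  exact (Summable.of_nonneg_of_le (fun n => by positivity) hle hf).tsum_le_tsum hle hf

theorem norm_le_norm_scaleReindex (hp : p ≠ ∞) {c : ℕ → ℝ} (hc : ∀ n, |c n| ≤ 1)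
    (hc' : ∀ n, 1 / 2 ≤ |c n|) {k : ℕ → ℕ} (hk : Function.Injective k) (f : SeqLp p) :
    ‖f‖ ≤ 2 * ‖scaleReindex hp c hc hk f‖ := by
  have hpos := toReal_pos_of_one_le hp
  rw [← Real.rpow_le_rpow_iff (norm_nonneg _) (by positivity) hpos,
    Real.mul_rpow (by norm_num) (norm_nonneg _), norm_scaleReindex_rpow,
    lp.norm_rpow_eq_tsum hpos, ← tsum_mul_left]
  have hf := (lp.memℓp f).summable hpos
  have hle : ∀ n, ‖c n * f n‖ ^ p.toReal ≤ ‖f n‖ ^ p.toReal := fun n => by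
    rw [norm_mul]
    exact Real.rpow_le_rpow (by positivity) (mul_le_of_le_one_left (norm_nonneg _) (hc n)) hpos.le
  refine hf.tsum_le_tsum (fun n => ?_)
    ((Summable.of_nonneg_of_le (fun n => by positivity) hle hf).mul_left _)
  rw [← Real.mul_rpow (by norm_num) (norm_nonneg _), norm_mul]
  refine Real.rpow_le_rpow (norm_nonneg _) ?_ hpos.le
  have := mul_le_mul_of_nonneg_right (hc' n) (norm_nonneg (f n))
  rw [Real.norm_eq_abs (c n)]
  linarith

theorem tendsto_scaleReindex_iff (hp : p ≠ ∞) {c : ℕ → ℝ} (hc : ∀ n, |c n| ≤ 1)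
    (hc' : ∀ n, 1 / 2 ≤ |c n|) {k : ℕ → ℕ} (hk : Function.Injective k) (s : ℕ → SeqLp p) :
    (∃ l, Tendsto s atTop (𝓝 l)) ↔
      ∃ l, Tendsto (fun n => scaleReindex hp c hc hk (s n)) atTop (𝓝 l) := by
  constructor
  · rintro ⟨l, hl⟩
    refine ⟨_, ((AddMonoidHomClass.continuous_of_bound (scaleReindex hp c hc hk) 1
      fun f => ?_).tendsto l).comp hl⟩
    rw [one_mul]
    exact norm_scaleReindex_le hp hc hk f
  · rintro ⟨l, hl⟩
    refine cauchySeq_tendsto_of_complete (Metric.cauchySeq_iff.2 fun δ hδ => ?_)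
    obtain ⟨N, hN⟩ := Metric.cauchySeq_iff.1 hl.cauchySeq (δ / 2) (half_pos hδ)
    refine ⟨N, fun m hm n hn => ?_⟩
    have h1 := hN m hm n hn
    rw [dist_eq_norm, ← map_sub] at h1
    have h2 := norm_le_norm_scaleReindex hp hc hc' hk (s m - s n)
    rw [dist_eq_norm]
    linarith

/-- Round `|a|` down to a multiple of `|b|`: since `|b| ≤ |a|`, at least half of it survives. -/
theorem exists_scaling {a b : ℝ} (hb : b ≠ 0) (hab : |b| ≤ |a|) :
    ∃ c : ℝ, |c| ≤ 1 ∧ 1 / 2 ≤ |c| ∧ c * a ∈ AddSubgroup.zmultiples b := by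
  have hb0 : 0 < |b| := abs_pos.2 hb
  have ha0 : 0 < |a| := lt_of_lt_of_le hb0 hab
  have ha : a ≠ 0 := abs_pos.1 ha0
  have h1 : (⌊|a| / |b|⌋ : ℝ) * |b| ≤ |a| := (le_div_iff₀ hb0).1 (Int.floor_le _)
  have h2 : |a| < ((⌊|a| / |b|⌋ : ℝ) + 1) * |b| := (div_lt_iff₀ hb0).1 (Int.lt_floor_add_one _)
  have h3 : (1 : ℤ) ≤ ⌊|a| / |b|⌋ :=
    Int.le_floor.2 (by rw [Int.cast_one]; exact (one_le_div hb0).2 hab)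
  have h3' : (1 : ℝ) ≤ ⌊|a| / |b|⌋ := by exact_mod_cast h3
  have habs : |(⌊|a| / |b|⌋ : ℝ) * b / a| = (⌊|a| / |b|⌋ : ℝ) * |b| / |a| := by
    rw [abs_div, abs_mul, abs_of_nonneg (by linarith : (0 : ℝ) ≤ ⌊|a| / |b|⌋)]
  refine ⟨(⌊|a| / |b|⌋ : ℝ) * b / a, ?_, ?_, ⟨⌊|a| / |b|⌋, ?_⟩⟩
  · rw [habs]
    exact (div_le_one ha0).2 h1
  · rw [habs, le_div_iff₀ ha0]
    nlinarith
  · simp only [zsmul_eq_mul]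
    field_simp

/-- Coordinate `n` is sent to a place `k n` where `b` is nonzero and no larger than a nonzero `a n`,
and rescaled to map `a n ℤ` into `b (k n) ℤ`. The map is bi-Lipschitz onto its image, so it
preserves and reflects convergence. -/
theorem subgroupA_borelReducible_subgroupA (hp : p ≠ ∞) (a : ℕ → ℝ) {b : ℕ → ℝ}
    (hb : Tendsto b atTop (𝓝 0)) (hinf : {n | b n ≠ 0}.Infinite) :
    BorelReducible (inducedEqRel (subgroupA p a)) (inducedEqRel (subgroupA p b)) := by
  have hfreq : ∀ n, ∃ᶠ k in atTop, b k ≠ 0 ∧ (a n ≠ 0 → |b k| ≤ |a n|) := by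
    intro n
    refine (Nat.frequently_atTop_iff_infinite.2 hinf).and_eventually ?_
    by_cases hn : a n = 0
    · simp [hn]
    · filter_upwards [hb.abs.eventually (gt_mem_nhds (by simpa using hn : |(0 : ℝ)| < |a n|))]
        with k hk _ using hk.le
  obtain ⟨k, hk, hk'⟩ := extraction_forall_of_frequently hfreq
  have hsc : ∀ n, ∃ c : ℝ, |c| ≤ 1 ∧ 1 / 2 ≤ |c| ∧ c * a n ∈ AddSubgroup.zmultiples (b (k n)) := by
    intro n
    by_cases hn : a n = 0
    · exact ⟨1, by simp, by norm_num, by rw [hn, mul_zero]; exact zero_mem _⟩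
    · exact exists_scaling (hk' n).1 ((hk' n).2 hn)
  choose c hc hc' hca using hsc
  let S := scaleReindex hp c hc hk.injective
  have hS : ∀ v : subgroupA p a, (S.comp (subgroupA p a).subtype) v ∈ subgroupA p b := by
    intro v i
    change Function.extend k (fun n => c n * (v : SeqLp p) n) 0 i ∈ _
    by_cases hi : ∃ n, k n = i
    · obtain ⟨n, rfl⟩ := hi
      rw [hk.injective.extend_apply]
      obtain ⟨m, hm⟩ := v.2 n
      simp only at hm
      rw [← hm, mul_smul_comm]
      exact zsmul_mem (hca n) m
    · rw [Function.extend_apply' _ _ _ hi]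
      exact zero_mem _
  have hcont : Continuous S := AddMonoidHomClass.continuous_of_bound S 1 fun f => by
    rw [one_mul]
    exact norm_scaleReindex_le hp hc hk.injective f
  refine borelReducible_of_hom ((S.comp (subgroupA p a).subtype).codRestrict _ hS)
    ((hcont.comp continuous_subtype_val).subtype_mk _) fun s => ?_
  rw [tendsto_subgroupA_iff a, tendsto_scaleReindex_iff hp hc hc' hk.injective,
    tendsto_subgroupA_iff b]
  rfl

end

theorem tendsto_inv_two_pow : Tendsto (fun n : ℕ => ((2 : ℝ) ^ n)⁻¹) atTop (𝓝 0) := by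
  simpa [inv_pow] using
    tendsto_pow_atTop_nhds_zero_of_lt_one (r := (1 : ℝ) / 2) (by norm_num) (by norm_num)

theorem infinite_inv_two_pow_ne_zero : {n : ℕ | ((2 : ℝ) ^ n)⁻¹ ≠ 0}.Infinite := by
  have : {n : ℕ | ((2 : ℝ) ^ n)⁻¹ ≠ 0} = Set.univ :=
    Set.eq_univ_of_forall fun n => inv_ne_zero (by positivity)
  rw [this]
  exact Set.infinite_univ

/-! ### The nonreducibility results -/

section

variable {p q : ℝ≥0∞} [hp1 : Fact (1 ≤ p)] [hq1 : Fact (1 ≤ q)]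

/-- The space `l_p` contains a whole line, hence all `2⁻ᵐ e` for one fixed `e`, so `V` may be
constant; discreteness of the coordinates of `A_p` rules this out. -/
theorem not_seqLp_borelReducible_subgroupDyadic (hp : p ≠ ∞) :
    ¬ BorelReducible (inducedEqRel (SeqLp p)) (inducedEqRel (subgroupDyadic p)) := by
  rintro ⟨f, hf, hred⟩
  have hp0 : 0 < p := lt_of_lt_of_le zero_lt_one hp1.out
  let e : SeqLp p := lp.single p 0 (1 : ℝ)
  have he : ‖e‖ ≤ 1 := by simp [e, lp.norm_single hp0]
  have hval : Continuous fun (x : ℕ → subgroupDyadic p) n => (x n : SeqLp p) :=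
    continuous_pi fun n => continuous_subtype_val.comp (continuous_apply n)
  obtain ⟨μ, v, hμ, hv, hnear⟩ := exists_dyadicEquiv_of_reduction hp (AddMonoidHom.id (SeqLp p))
    (fun s => Iff.rfl) (f := fun x n => (f x n : SeqLp p)) (hval.borel_measurable.comp hf)
    (fun x y => (hred x y).trans (tendsto_subgroupA_iff _ fun n => f x n - f y n))
    (V := fun _ => e) (fun _ => he) (β := fun m => ((1 : ℝ) / 2) ^ m • e) (fun _ => rfl)
    (subgroupDyadic p) fun x k => (f x k).2
  obtain ⟨B, hB⟩ := hv.exists_norm_le fun _ => he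
  exact not_dyadicEquiv_const hp e (lp.evalCLM ℝ (fun _ : ℕ => ℝ) p 0) (by
    change (lp.single p 0 (1 : ℝ) : SeqLp p) 0 = 1
    exact lp.single_apply_self p 0 1)
    (tendsto_apply_zero_of_near_dyadic hB hnear) hv

/-- The mesh `2⁻ᵐ` at coordinate `m` is exactly what puts `2⁻ᵐ` times the unit vector in `A_p`, so
`V` may be the unit vectors; no constraint on the values is needed, hence `⊤`. -/
theorem eq_of_subgroupDyadic_borelReducible_seqLp (hp : p ≠ ∞) (hq : q ≠ ∞)
    (h : BorelReducible (inducedEqRel (subgroupDyadic p)) (inducedEqRel (SeqLp q))) : p = q := by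
  obtain ⟨f, hf, hred⟩ := h
  have hp0 : 0 < p := lt_of_lt_of_le zero_lt_one hp1.out
  have hmem : ∀ m, ((1 : ℝ) / 2) ^ m • (lp.single p m (1 : ℝ) : SeqLp p) ∈ subgroupDyadic p := by
    intro m i
    change ((1 : ℝ) / 2) ^ m * (lp.single p m (1 : ℝ) : SeqLp p) i ∈ _
    rcases eq_or_ne i m with rfl | h
    · rw [lp.single_apply_self, mul_one, one_div, inv_pow]
      exact AddSubgroup.mem_zmultiples _
    · rw [lp.single_apply_ne _ _ _ h, mul_zero]
      exact zero_mem _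
  obtain ⟨μ, v, hμ, hv, -⟩ := @exists_dyadicEquiv_of_reduction p q _ _ hq (subgroupDyadic p)
    (subgroupDyadic p).toAddCommGroup instTopologicalSpaceSubtype _ (subgroupDyadic p).subtype
    (tendsto_subgroupA_iff _) f hf hred (fun m => lp.single p m (1 : ℝ))
    (fun m => by simp [lp.norm_single hp0]) (fun m => ⟨_, hmem m⟩) (fun _ => rfl)
    ⊤ fun _ _ => trivial
  exact eq_of_dyadicEquiv_single hp hq hμ hv

end

theorem mainTheorem12 (p q : ℝ≥0∞) [Fact (1 ≤ p)] [Fact (1 ≤ q)] (hp : p ≠ ∞) (hq : q ≠ ∞)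
    (a : ℕ → ℝ) (ha : Tendsto a atTop (𝓝 0)) :
    ({n : ℕ | a n ≠ 0}.Nonempty → {n : ℕ | a n ≠ 0}.Finite →
      BorelBireducible (inducedEqRel (subgroupA p a)) eqRelE0) ∧
    ({n : ℕ | a n ≠ 0}.Infinite →
      BorelBireducible (inducedEqRel (subgroupA p a)) (inducedEqRel (subgroupDyadic p))) ∧
    StrictlyBorelReducible (inducedEqRel (subgroupDyadic p)) (inducedEqRel (SeqLp p)) ∧
    (BorelReducible (inducedEqRel (subgroupDyadic p)) (inducedEqRel (SeqLp q)) ↔ p = q) ∧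
    (BorelReducible (inducedEqRel (subgroupDyadic p)) (inducedEqRel (subgroupDyadic q)) ↔
      p = q) := by
  refine ⟨subgroupA_bireducible_eqRelE0, fun hinf => ⟨?_, ?_⟩,
    ⟨subgroupA_borelReducible_seqLp _, not_seqLp_borelReducible_subgroupDyadic hp⟩,
    ⟨eq_of_subgroupDyadic_borelReducible_seqLp hp hq, ?_⟩,
    ⟨fun h => eq_of_subgroupDyadic_borelReducible_seqLp hp hq
      (h.trans (subgroupA_borelReducible_seqLp _)), ?_⟩⟩
  · exact subgroupA_borelReducible_subgroupA hp a tendsto_inv_two_pow infinite_inv_two_pow_ne_zero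
  · exact subgroupA_borelReducible_subgroupA hp _ ha hinf
  · rintro rfl
    exact subgroupA_borelReducible_seqLp _
  · rintro rfl
    exact ⟨id, measurable_id, fun _ _ => Iff.rfl⟩
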